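/- Let $\mathbb F_q$ be a finite field with $q$ elements and $\mathbb N=\{1,2,\dots\}$. Let $\Gamma=\{x_{n,\varepsilon} : n\in\mathbb N,\ \varepsilon\in\mathbb F_q^*\}$ be an alphabet, $\langle\Gamma\rangle$ the set of words over $\Gamma$ (with empty word $1$), and let $\mathfrak D=\mathbb F_q\langle\Gamma\rangle$ be the $\mathbb F_q$-vector space with basis $\langle\Gamma\rangle$. The depth of a word is its number of letters; the letter $x_{n,\varepsilon}$ has weight $n$ and the weight $w$ of a word is the sum of the weights of its letters. For $r,s\ge 1$ and $1\le i<r+s$ put $$\Delta^i_{r,s}=(-1)^{r-1}\binom{i-1}{r-1}+(-1)^{s-1}\binom{i-1}{s-1}\ \text{ if } (q-1)\mid i,\qquad \Delta^i_{r,s}=0\ \text{ otherwise.}$$ Define bilinear products $\diamond$ and $\mathbin{\sqcup\!\sqcup}$ on $\mathfrak D$ recursively by $1\diamond\mathfrak a=\mathfrak a\diamond 1=\mathfrak a=1\mathbin{\sqcup\!\sqcup}\mathfrak a=\mathfrak a\mathbin{\sqcup\!\sqcup}1$ and, for nonempty words $\mathfrak a=x_{a,\alpha}\mathfrak a_-$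 and $\mathfrak b=x_{b,\beta}\mathfrak b_-$, $$\mathfrak a\diamond\mathfrak b=x_{a+b,\alpha\beta}(\mathfrak a_-\mathbin{\sqcup\!\sqcup}\mathfrak b_-)+\sum_{i+j=a+b}\Delta^j_{a,b}\,x_{i,\alpha\beta}\bigl(x_{j,1}\mathbin{\sqcup\!\sqcup}(\mathfrak a_-\mathbin{\sqcup\!\sqcup}\mathfrak b_-)\bigr),$$ $$\mathfrak a\mathbin{\sqcup\!\sqcup}\mathfrak b=x_{a,\alpha}(\mathfrak a_-\mathbin{\sqcup\!\sqcup}\mathfrak b)+x_{b,\beta}(\mathfrak a\mathbin{\sqcup\!\sqcup}\mathfrak b_-)+\mathfrak a\diamond\mathfrak b,$$ where $i,j\ge 1$. For a finite sequence $\mathbf i=(i_1,\dots,i_m)$ of positive integers with sum $|\mathbf i|$ put $$[\mathbf i]=(-1)^m\Delta^{i_1}_{1,|\mathbf i|+1}\cdots\Delta^{i_m}_{1,|\mathbf i|+1}\;x_{i_1,1}\mathbin{\sqcup\!\sqcup}\cdots\mathbin{\sqcup\!\sqcup}x_{i_m,1},\qquad [\emptyset]=1 .$$ Define a linear map $\Delta:\mathfrak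 D\to\mathfrak D\otimes\mathfrak D$ by $\Delta(1)=1\otimes 1$, by $$\Delta(x_{n,\varepsilon})=1\otimes x_{n,\varepsilon}+\sum_{r\ge 1,\ m\ge 0,\ \mathbf i\in\mathbb N^m,\ r+|\mathbf i|=n}\binom{r+m-2}{m}\,x_{r,\varepsilon}\otimes[\mathbf i],\qquad\text{where }\binom{-1}{0}=1,$$ and, recursively on the depth, for a letter $x$ and a nonempty word $\mathfrak v$ with $\Delta(x)=1\otimes x+\sum a_x\otimes b_x$ and $\Delta(\mathfrak v)=\sum a_{\mathfrak v}\otimes b_{\mathfrak v}$, by $$\Delta(x\mathfrak v)=1\otimes x\mathfrak v+\sum (a_x a_{\mathfrak v})\otimes(b_x\mathbin{\sqcup\!\sqcup}b_{\mathfrak v}),$$ where $a_xa_{\mathfrak v}$ is the concatenation. Let $u:\mathbb F_q\to\mathfrak D$ be the linear map sending $1$ to the empty word, and let $\epsilon:\mathfrak D\to\mathbb F_q$ be the linear map with $\epsilon(1)=1$ and $\epsilon(\mathfrak u)=0$ for every nonempty word $\mathfrak u$. Theorem. $(\mathfrak D,\mathbin{\sqcup\!\sqcup},u,\Delta,\epsilon)$,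 with the grading $\mathfrak D=\bigoplus_{n\ge 0}\mathfrak D_n$ in which $\mathfrak D_n$ is spanned by the words of weight $n$, is a (commutative) connected graded Hopf algebra of finite type over $\mathbb F_q$: it is a bialgebra with an antipode $S$; $\mathfrak D_r\mathbin{\sqcup\!\sqcup}\mathfrak D_s\subseteq\mathfrak D_{r+s}$, $\Delta(\mathfrak D_n)\subseteq\bigoplus_{i+j=n}\mathfrak D_i\otimes\mathfrak D_j$ and $S(\mathfrak D_n)\subseteq\mathfrak D_n$; $\mathfrak D_0=u(\mathbb F_q)$; and every $\mathfrak D_n$ is finite-dimensional. The antipode is the one given by the connected graded bialgebra structure: $S(x)=x$ for $x\in\mathfrak D_0$, and each $x\in\mathfrak D_n$ with $n\ge1$ satisfies $\Delta(x)=1\otimes x+x\otimes 1+\sum x_{(1)}\otimes x_{(2)}$ with $\sum x_{(1)}\otimes x_{(2)}\in\bigoplus_{i+j=n,\ i,j>0}\mathfrak D_i\otimes\mathfrak D_j$ and $S(x)=-x-\sum S(x_{(1)})\mathbin{\sqcup\!\sqcup}x_{(2)}$. -/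

import Mathlib

open scoped TensorProduct

universe u

noncomputable section

namespace AMZV

/-! ### Graded Hopf algebras -/

section Graded

variable {k A : Type u} [Field k] [Ring A] [HopfAlgebra k A]

/-- `⨁_{i + j = n} H_i ⊗ H_j` inside `H ⊗ H`. -/
def tensorDegree (𝒜 : ℕ → Submodule k A) (n : ℕ) : Submodule k (A ⊗[k] A) :=
  ⨆ (i : ℕ) (j : ℕ) (_ : i + j = n), Submodule.map₂ (TensorProduct.mk k A A) (𝒜 i) (𝒜 j)

/-- `⨁_{i + j = n, i > 0, j > 0} H_i ⊗ H_j` inside `H ⊗ H`. -/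
def reducedTensorDegree (𝒜 : ℕ → Submodule k A) (n : ℕ) : Submodule k (A ⊗[k] A) :=
  ⨆ (i : ℕ) (j : ℕ) (_ : i + j = n ∧ 0 < i ∧ 0 < j),
    Submodule.map₂ (TensorProduct.mk k A A) (𝒜 i) (𝒜 j)

/-- The Hopf algebra `A` over `k` is graded by the subspaces `𝒜 n`. -/
structure IsGradedHopf (𝒜 : ℕ → Submodule k A) : Prop where
  isInternal : DirectSum.IsInternal 𝒜
  mul_mem : ∀ r s : ℕ, ∀ x ∈ 𝒜 r, ∀ y ∈ 𝒜 s, x * y ∈ 𝒜 (r + s)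
  comul_mem : ∀ n : ℕ, ∀ x ∈ 𝒜 n, (Coalgebra.comul (R := k) x) ∈ tensorDegree 𝒜 n
  antipode_mem : ∀ n : ℕ, ∀ x ∈ 𝒜 n, HopfAlgebra.antipode k x ∈ 𝒜 n

/-- A grading is connected if its degree zero part is `k` (that is, the image of the unit map,
which is injective in any bialgebra over a field because the counit is a left inverse). -/
def IsConnected (𝒜 : ℕ → Submodule k A) : Prop :=
  𝒜 0 = LinearMap.range (Algebra.linearMap k A)

/-- A grading is of finite type if every homogeneous part is finite-dimensional. -/
def IsFiniteType (𝒜 : ℕ → Submodule k A) : Prop :=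
  ∀ n : ℕ, FiniteDimensional k (𝒜 n)

/-- In a connected graded bialgebra, `Δ(x) = 1 ⊗ x + x ⊗ 1 + ∑ x₍₁₎ ⊗ x₍₂₎` for `x` of degree
`n ≥ 1`, where the last sum lies in `⨁_{i + j = n, i > 0, j > 0} H_i ⊗ H_j`, and the antipode is
given recursively by `S(x) = x` in degree zero and `S(x) = - x - ∑ S(x₍₁₎) x₍₂₎` in degree
`n ≥ 1`. -/
def AntipodeIsRecursive (𝒜 : ℕ → Submodule k A) : Prop :=
  (∀ x ∈ 𝒜 0, HopfAlgebra.antipode k x = x) ∧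
  ∀ n : ℕ, 1 ≤ n → ∀ x ∈ 𝒜 n, ∃ t ∈ reducedTensorDegree 𝒜 n,
    Coalgebra.comul (R := k) x = 1 ⊗ₜ[k] x + x ⊗ₜ[k] 1 + t ∧
    HopfAlgebra.antipode k x
      = - x - LinearMap.mul' k A ((HopfAlgebra.antipode k (A := A)).rTensor A t)

end Graded

/-! ### The word algebra -/

section WordAlgebra

variable (F : Type u) [Field F]

/-- The alphabet `Γ`: the pair `(n, ε)` is the letter `x_{n,ε}`, with `n ≥ 1`, `ε ∈ F^*`. -/
abbrev Letter : Type u := ℕ+ × Fˣ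

/-- The words over the alphabet `Γ`. The depth of a word is its length. -/
abbrev Word : Type u := List (Letter F)

/-- The space `𝔇 = F⟨Γ⟩`: the free vector space with basis the words over `Γ`. -/
abbrev WordAlgebra : Type u := Word F →₀ F

variable {F}

/-- A word as an element of `𝔇`. -/
def word (w : Word F) : WordAlgebra F := Finsupp.single w 1

/-- The weight of a word: the letter `x_{n,ε}` has weight `n`. -/
def weight (w : Word F) : ℕ := (w.map fun x => (x.1 : ℕ)).sum

/-- The linear map `𝔇 → 𝔇` that puts the letter `x` in front of each word. -/
def cons (x : Letter F) : WordAlgebra F →ₗ[F] WordAlgebra F :=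
  Finsupp.lmapDomain F F (List.cons x)

/-- The linear extension to `𝔇` of a function defined on words. -/
def linExt {M : Type u} [AddCommMonoid M] [Module F M] (f : Word F → M) : WordAlgebra F →ₗ[F] M :=
  Finsupp.linearCombination F f

/-- The bilinear extension to `𝔇` of a function defined on pairs of words. -/
def bilinExt (f : Word F → Word F → WordAlgebra F) :
    WordAlgebra F →ₗ[F] WordAlgebra F →ₗ[F] WordAlgebra F :=
  Finsupp.linearCombination F fun a => linExt (f a)

/-- The concatenation product. -/
def concat : WordAlgebra F →ₗ[F] WordAlgebra F →ₗ[F] WordAlgebra F :=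
  bilinExt fun a b => word (a ++ b)

/-- The pairs `(i, j)` of positive integers with `i + j = n`. -/
def pairsWithSum (n : ℕ+) : Finset (ℕ+ × ℕ+) :=
  (Finset.Icc 1 n ×ˢ Finset.Icc 1 n).filter fun p => p.1 + p.2 = n

variable (F) in
/-- The coefficient `Δ^i_{r,s}` for positive integers `r`, `s`, `i` with `i < r + s`, where
`q` is the cardinality of `F`. -/
def delta (r s i : ℕ) : F :=
  if Nat.card F - 1 ∣ i then
    (-1) ^ (r - 1) * ((i - 1).choose (r - 1) : F) + (-1) ^ (s - 1) * ((i - 1).choose (s - 1) : F)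
  else 0

/-! ### The diamond and shuffle products

The shuffle product of a letter and a word is defined first. This makes the double recursion in
the definition of the shuffle product of two words well founded without any further argument:
the inner product `x_{j,1} ⧢ (𝔞₋ ⧢ 𝔟₋)` is a product with a letter. The recursion in its usual
form, for the bilinear products, is then proved in `shuffle_word_cons_word_cons` and
`diamond_word_cons_word_cons`. -/

/-- The shuffle product of a letter and a word. -/
def letterShuffle : Letter F → Word F → WordAlgebra F
  | x, [] => word [x]
  | x, y :: b =>
      cons x (word (y :: b)) + cons y (letterShuffle x b)
        + (cons (x.1 + y.1, x.2 * y.2) (word b)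
          + ∑ p ∈ pairsWithSum (x.1 + y.1),
              delta F x.1 y.1 p.2 • cons (p.1, x.2 * y.2) (letterShuffle (p.2, 1) b))

/-- The shuffle product of two words. -/
def wordShuffle : Word F → Word F → WordAlgebra F
  | [], b => word b
  | x :: a, [] => word (x :: a)
  | x :: a, y :: b =>
      cons x (wordShuffle a (y :: b)) + cons y (wordShuffle (x :: a) b)
        + (cons (x.1 + y.1, x.2 * y.2) (wordShuffle a b)
          + ∑ p ∈ pairsWithSum (x.1 + y.1),
              delta F x.1 y.1 p.2 •
                cons (p.1, x.2 * y.2) (linExt (letterShuffle (p.2, 1)) (wordShuffle a b)))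
termination_by a b => a.length + b.length

/-- The shuffle product `⧢` on `𝔇`. -/
def shuffle : WordAlgebra F →ₗ[F] WordAlgebra F →ₗ[F] WordAlgebra F := bilinExt wordShuffle

/-- The diamond product of two words. -/
def wordDiamond : Word F → Word F → WordAlgebra F
  | [], b => word b
  | x :: a, [] => word (x :: a)
  | x :: a, y :: b =>
      cons (x.1 + y.1, x.2 * y.2) (shuffle (word a) (word b))
        + ∑ p ∈ pairsWithSum (x.1 + y.1),
            delta F x.1 y.1 p.2 • cons (p.1, x.2 * y.2)
              (shuffle (word [(p.2, 1)]) (shuffle (word a) (word b)))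

/-- The diamond product on `𝔇`. -/
def diamond : WordAlgebra F →ₗ[F] WordAlgebra F →ₗ[F] WordAlgebra F := bilinExt wordDiamond

@[simp] theorem linExt_word {M : Type u} [AddCommMonoid M] [Module F M] (f : Word F → M)
    (w : Word F) : linExt f (word w) = f w := by
  simp [linExt, word]

@[simp] theorem bilinExt_word_word (f : Word F → Word F → WordAlgebra F) (a b : Word F) :
    bilinExt f (word a) (word b) = f a b := by
  simp [bilinExt, word, linExt]

@[simp] theorem cons_word (x : Letter F) (w : Word F) : cons x (word w) = word (x :: w) := by
  simp [cons, word]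

theorem shuffle_word_word (a b : Word F) : shuffle (word a) (word b) = wordShuffle a b :=
  bilinExt_word_word _ a b

theorem linExt_ext {M : Type u} [AddCommMonoid M] [Module F M] {f g : WordAlgebra F →ₗ[F] M}
    (h : ∀ w, f (word w) = g (word w)) : f = g :=
  Finsupp.lhom_ext' fun w => LinearMap.ext_ring (h w)

theorem wordShuffle_nil_right (a : Word F) : wordShuffle a [] = word a := by
  cases a <;> simp [wordShuffle]

theorem wordShuffle_singleton (x : Letter F) (b : Word F) :
    wordShuffle [x] b = letterShuffle x b := by
  induction b generalizing x with
  | nil => simp [wordShuffle, letterShuffle]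
  | cons y b ih => simp [wordShuffle, letterShuffle, ih]

theorem linExt_letterShuffle (x : Letter F) (v : WordAlgebra F) :
    linExt (letterShuffle x) v = shuffle (word [x]) v := by
  have h : linExt (letterShuffle x) = shuffle (word [x]) :=
    linExt_ext fun w => by rw [linExt_word, shuffle_word_word, wordShuffle_singleton]
  rw [h]

/-- `1 ⧢ 𝔞 = 𝔞`. -/
theorem shuffle_word_nil_left (v : WordAlgebra F) : shuffle (word []) v = v := by
  have h : shuffle (word []) = (LinearMap.id : WordAlgebra F →ₗ[F] WordAlgebra F) :=
    linExt_ext fun w => by rw [shuffle_word_word]; simp [wordShuffle]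
  rw [h, LinearMap.id_apply]

/-- `𝔞 ⧢ 1 = 𝔞`. -/
theorem shuffle_word_nil_right (v : WordAlgebra F) : shuffle v (word []) = v := by
  have h : (shuffle (F := F)).flip (word []) = LinearMap.id :=
    linExt_ext fun w => by
      rw [LinearMap.flip_apply, shuffle_word_word, wordShuffle_nil_right, LinearMap.id_apply]
  exact LinearMap.congr_fun h v

/-- `𝔞 ⋄ 𝔟 = x_{a+b,αβ} (𝔞₋ ⧢ 𝔟₋) + ∑_{i+j=a+b} Δ^j_{a,b} x_{i,αβ} (x_{j,1} ⧢ (𝔞₋ ⧢ 𝔟₋))`. -/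
theorem diamond_word_cons_word_cons (x y : Letter F) (a b : Word F) :
    diamond (word (x :: a)) (word (y :: b)) =
      cons (x.1 + y.1, x.2 * y.2) (shuffle (word a) (word b))
        + ∑ p ∈ pairsWithSum (x.1 + y.1),
            delta F x.1 y.1 p.2 • cons (p.1, x.2 * y.2)
              (shuffle (word [(p.2, 1)]) (shuffle (word a) (word b))) := by
  rw [diamond, bilinExt_word_word, wordDiamond]

/-- `𝔞 ⧢ 𝔟 = x_{a,α} (𝔞₋ ⧢ 𝔟) + x_{b,β} (𝔞 ⧢ 𝔟₋) + 𝔞 ⋄ 𝔟`. -/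
theorem shuffle_word_cons_word_cons (x y : Letter F) (a b : Word F) :
    shuffle (word (x :: a)) (word (y :: b)) =
      cons x (shuffle (word a) (word (y :: b))) + cons y (shuffle (word (x :: a)) (word b))
        + diamond (word (x :: a)) (word (y :: b)) := by
  rw [diamond_word_cons_word_cons]
  simp only [shuffle_word_word, ← linExt_letterShuffle]
  rw [wordShuffle]

/-! ### The coproduct -/

/-- The weight of a word over the alphabet `Σ = {x_n}`, where `n` stands for the letter `x_n`. -/
def sigmaWeight (a : List ℕ+) : ℕ := (a.map fun i => (i : ℕ)).sum

theorem finite_sigmaWeight_eq (n : ℕ) : {a : List ℕ+ | sigmaWeight a = n}.Finite := by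
  induction n using Nat.strong_induction_on with
  | _ n ih =>
    refine ((Set.finite_singleton ([] : List ℕ+)).union
      ((Set.finite_Iio n).biUnion fun m hm =>
        ((ih m hm).image (List.cons (Nat.toPNat' (n - m)))))).subset ?_
    rintro (_ | ⟨i, a⟩) h
    · simp
    · right
      have h' : (i : ℕ) + sigmaWeight a = n := by simpa [sigmaWeight] using h
      have hi := i.pos
      refine Set.mem_biUnion (x := sigmaWeight a) (by simp only [Set.mem_Iio]; omega)
        ⟨a, rfl, ?_⟩
      have : n - sigmaWeight a = (i : ℕ) := by omega
      rw [this, PNat.coe_toPNat']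

theorem finite_splittings (n : ℕ) :
    {p : ℕ+ × List ℕ+ | (p.1 : ℕ) + sigmaWeight p.2 = n}.Finite := by
  refine ((finite_sigmaWeight_eq n).preimage
    (f := fun p : ℕ+ × List ℕ+ => p.1 :: p.2) ?_).subset ?_
  · rintro ⟨r, a⟩ _ ⟨s, b⟩ _ h
    simpa using h
  · rintro ⟨r, a⟩ h
    simpa [sigmaWeight] using h

/-- The finite set of all pairs `(r, 𝔞)` with `r ≥ 1`, `𝔞` a word over `Σ`, `r + w(𝔞) = n`. -/
def splittings (n : ℕ) : Finset (ℕ+ × List ℕ+) := (finite_splittings n).toFinset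

variable (F) in
/-- The bracket operator
`[x_{i_1} ⋯ x_{i_m}] = (-1)^m Δ^{i_1}_{1,w+1} ⋯ Δ^{i_m}_{1,w+1} x_{i_1} ⧢ ⋯ ⧢ x_{i_m}`, where
`w = i_1 + ⋯ + i_m` and `x_i` is identified with `x_{i,1}`. -/
def bracket (a : List ℕ+) : WordAlgebra F :=
  ((-1) ^ a.length * (a.map fun i => delta F 1 (sigmaWeight a + 1) i).prod) •
    (a.map fun i => word [((i, 1) : Letter F)]).foldr (fun v w => shuffle v w) (word [])

/-- `Δ(x_{n,ε}) - 1 ⊗ x_{n,ε}`, that is,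
`∑_{r + w(𝔞) = n} binom(r + depth(𝔞) - 2, depth(𝔞)) x_{r,ε} ⊗ [𝔞]`. -/
def letterTail (x : Letter F) : WordAlgebra F ⊗[F] WordAlgebra F :=
  ∑ p ∈ splittings x.1,
    ((Ring.choose ((p.1 : ℤ) + (p.2.length : ℤ) - 2) p.2.length : ℤ) : F) •
      (word [((p.1, x.2) : Letter F)] ⊗ₜ[F] bracket F p.2)

/-- The coproduct of a word: `Δ(1) = 1 ⊗ 1`, and
`Δ(x 𝔳) = 1 ⊗ x 𝔳 + ∑ (a_x a_𝔳) ⊗ (b_x ⧢ b_𝔳)` where `Δ(x) = 1 ⊗ x + ∑ a_x ⊗ b_x` and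
`Δ(𝔳) = ∑ a_𝔳 ⊗ b_𝔳`. -/
def wordComul : Word F → WordAlgebra F ⊗[F] WordAlgebra F
  | [] => word [] ⊗ₜ[F] word []
  | x :: v =>
      word [] ⊗ₜ[F] word (x :: v) + TensorProduct.map₂ concat shuffle (letterTail x) (wordComul v)

/-- The coproduct `Δ` on `𝔇`. -/
def comul : WordAlgebra F →ₗ[F] WordAlgebra F ⊗[F] WordAlgebra F := linExt wordComul

theorem concat_word_nil_right (v : WordAlgebra F) : concat v (word []) = v := by
  have h : (concat (F := F)).flip (word []) = LinearMap.id :=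
    linExt_ext fun w => by simp [concat]
  exact LinearMap.congr_fun h v

/-- `Δ(x_{n,ε}) = 1 ⊗ x_{n,ε} +
∑_{r + w(𝔞) = n} binom(r + depth(𝔞) - 2, depth(𝔞)) x_{r,ε} ⊗ [𝔞]`. -/
theorem comul_letter (x : Letter F) :
    comul (word [x]) = word [] ⊗ₜ[F] word [x] + letterTail x := by
  simp [comul, wordComul, letterTail, concat_word_nil_right, shuffle_word_nil_right]

/-- The recursion on the depth for the coproduct. -/
theorem comul_cons (x : Letter F) (v : Word F) :
    comul (word (x :: v)) = word [] ⊗ₜ[F] word (x :: v) +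
      TensorProduct.map₂ concat shuffle (letterTail x) (comul (word v)) := by
  simp [comul, wordComul]

/-- The unit `u : F → 𝔇`, sending `1` to the empty word. -/
def unit : F →ₗ[F] WordAlgebra F := LinearMap.toSpanSingleton F _ (word [])

/-- The counit `ε : 𝔇 → F`: `ε(1) = 1`, and `ε(𝔲) = 0` for each nonempty word `𝔲`. -/
def counit : WordAlgebra F →ₗ[F] F := linExt fun w => if w = [] then 1 else 0

variable (F) in
/-- The homogeneous part of weight `n` of `𝔇`: the span of the words of weight `n`. -/
def weightPart (n : ℕ) : Submodule F (WordAlgebra F) :=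
  Submodule.span F (word '' {w : Word F | weight w = n})

end WordAlgebra

end AMZV

end

noncomputable section

namespace AMZV

/-! ### Partial fractions -/

section PartialFractions

variable {R : Type*} [CommRing R]

/-! The axioms are not checked by recursion on words. They are read off from a faithful family of
evaluations in an algebraically closed field `K` over `F`. Take `F`-independent elements t₁, …, t_m
of `K`, each decorated with a natural number kᵢ, and let Vᵢ be the span of the first i of them. At
step i the letter x_{n,ε} contributes ε^{kᵢ} ∑ (tᵢ + v)⁻ⁿ, with v in Vᵢ₋₁. A word is evaluated as a
nested sum over strictly decreasing steps (`evalWord`), like a truncated alternating multiple zeta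
value with a flag in place of the polynomials of bounded degree.

Product: partial fractions give Chen's formula `powerSum_mul_powerSum`, whose shape is that of the
diamond product. Hence evaluation turns ⧢ into the product of `K` (`evalLin_shuffle`).

Coproduct: let e_c be the normalized additive polynomial vanishing on the span of the flag c. The
power sums at z have generating series X/(e_c(z) - e_c(X)), and those at 0 have 1 - X/e_c(X).
Expanding the first in powers of 1/e_c(z) produces the binomial coefficients and the brackets of Δ.
So evaluating v at a concatenation c' ++ c is evaluating Δ(v) at the pair (e_c(c'), c)
(`evalTensor_comul`).

Faithfulness: the evaluations of distinct words are linearly independent over `K`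
(`linearIndependent_evalWord`), and so are those of tensors of words. As e_c is surjective, every
pair of flags has the form (e_c(c'), c). Thus commutativity and associativity come from `K`,
coassociativity from concatenation of lists, and multiplicativity of Δ from `evalLin_shuffle` and
`evalTensor_comul` together. The counit is evaluation at the empty flag.

Antipode: in the convolution algebra the identity is 1 + J with J = id - uε. Since Jⁿ kills degrees
below n, the geometric series for (1 + J)⁻¹ is finite on each degree. It is two-sided inverse to the
identity and preserves degrees. -/

/-- The polar part at one of the two poles in the partial fraction decomposition. -/
def polarPart (g p : R) (a b : ℕ) : R :=
  ∑ k ∈ Finset.range a, ((b + k - 1).choose k : R) * p ^ (a - k) * g ^ (b + k)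

theorem polarPart_succ_succ (g p : R) (a b : ℕ) :
    polarPart g p (a + 1) (b + 1)
      = g * (polarPart g p (a + 1) b + polarPart g p a (b + 1)) := by
  unfold polarPart
  rw [Finset.sum_range_succ', mul_add, Finset.mul_sum, Finset.mul_sum, Finset.sum_range_succ' _ a]
  refine Eq.trans ?_ (add_right_comm _ _ _)
  rw [← Finset.sum_add_distrib]
  congr 1
  · refine Finset.sum_congr rfl fun k _ => ?_
    have h : (b + 1 + (k + 1) - 1).choose (k + 1)
        = (b + (k + 1) - 1).choose (k + 1) + (b + 1 + k - 1).choose k := by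
      have e1 : b + 1 + (k + 1) - 1 = (b + k) + 1 := by omega
      have e2 : b + (k + 1) - 1 = b + k := by omega
      have e3 : b + 1 + k - 1 = b + k := by omega
      rw [e1, e2, e3, Nat.choose_succ_succ, add_comm]
    rw [h, Nat.add_sub_add_right]
    push_cast
    ring
  · simp
    ring

/-- The model is p = 1/P, r = 1/Q, g = 1/(P - Q), written without division. Both sides satisfy the
same recursion in `(a, b)`: the left by the relation `h`, the right by Pascal's rule in
`polarPart_succ_succ`. At a = b = 0 both polar parts are empty sums, so that case is excluded. -/
theorem partial_fractions {g p r : R} (h : p * r = g * (r - p)) (a b : ℕ) (hab : a + b ≠ 0) :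
    p ^ a * r ^ b = (-1) ^ b * polarPart g p a b + (-1) ^ a * polarPart (-g) r b a := by
  have hz : ∀ (g p : R) (a : ℕ), a ≠ 0 → polarPart g p a 0 = p ^ a := by
    intro g p a ha
    obtain ⟨a, rfl⟩ := Nat.exists_eq_succ_of_ne_zero ha
    rw [polarPart, Finset.sum_range_succ', Finset.sum_eq_zero]
    · simp
    · intro k _
      simp
  have hz' : ∀ (g p : R) (b : ℕ), polarPart g p 0 b = 0 := by intro g p b; simp [polarPart]
  induction a generalizing b with
  | zero => rw [hz _ _ _ (by omega), hz']; simp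
  | succ a iha =>
    induction b with
    | zero => rw [hz _ _ _ (by omega), hz']; simp
    | succ b ihb =>
      have e : p ^ (a + 1) * r ^ (b + 1) = g * (p ^ a * r ^ (b + 1) - p ^ (a + 1) * r ^ b) := by
        linear_combination (p ^ a * r ^ b) * h
      rw [e, iha (b + 1) (by omega), ihb (by omega), polarPart_succ_succ, polarPart_succ_succ]
      ring

theorem mem_pairsWithSum {n : ℕ+} {p : ℕ+ × ℕ+} : p ∈ pairsWithSum n ↔ p.1 + p.2 = n := by
  unfold pairsWithSum
  simp only [Finset.mem_filter, Finset.mem_product, Finset.mem_Icc, one_le, true_and,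
    and_iff_right_iff_imp]
  rintro rfl
  exact ⟨(PNat.lt_add_right _ _).le, (PNat.lt_add_left _ _).le⟩

theorem polarPart_eq_sum (g p : R) (a b n : ℕ+) (h : a + b = n) :
    polarPart g p a b = ∑ s ∈ pairsWithSum n,
      (((s.2 : ℕ) - 1).choose ((b : ℕ) - 1) : R) * p ^ (s.1 : ℕ) * g ^ (s.2 : ℕ) := by
  have hn : (a : ℕ) + b = n := by rw [← h]; rfl
  have ha := a.pos
  have hb := b.pos
  unfold polarPart
  symm
  -- The substitution is j = b + k. Pairs with `s.2 < b` carry a vanishing binomial, so the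
  -- truncated subtraction is only used where it is exact.
  refine Finset.sum_bij_ne_zero (fun s _ _ => (s.2 : ℕ) - b) ?_ ?_ ?_ ?_
  · intro s hs hne
    have h1 : (s.1 : ℕ) + s.2 = n := by rw [← mem_pairsWithSum.1 hs]; rfl
    have := s.1.pos
    rw [Finset.mem_range]
    omega
  · intro s hs hne s' hs' hne' hss
    have h1 : (s.1 : ℕ) + s.2 = n := by rw [← mem_pairsWithSum.1 hs]; rfl
    have h1' : (s'.1 : ℕ) + s'.2 = n := by rw [← mem_pairsWithSum.1 hs']; rfl
    have key : ∀ m : ℕ+, (((m : ℕ) - 1).choose ((b : ℕ) - 1) : R) ≠ 0 → (b : ℕ) ≤ m := by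
      intro m hm
      by_contra hlt
      have := m.pos
      exact hm (by rw [Nat.choose_eq_zero_of_lt (by omega), Nat.cast_zero])
    have h2 := key s.2 (left_ne_zero_of_mul (left_ne_zero_of_mul hne))
    have h2' := key s'.2 (left_ne_zero_of_mul (left_ne_zero_of_mul hne'))
    refine Prod.ext (PNat.coe_injective ?_) (PNat.coe_injective ?_) <;> omega
  · intro k hk hne
    rw [Finset.mem_range] at hk
    refine ⟨(⟨a - k, by omega⟩, ⟨b + k, by omega⟩), ?_, ?_, ?_⟩
    · rw [mem_pairsWithSum]
      apply PNat.coe_injective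
      change (a - k : ℕ) + (b + k) = n
      omega
    · change ((b + k - 1).choose (b - 1) : R) * p ^ (a - k : ℕ) * g ^ (b + k : ℕ) ≠ 0
      rwa [show (b : ℕ) - 1 = b + k - 1 - k by omega, Nat.choose_symm (by omega)]
    · change (b : ℕ) + k - b = k
      omega
  · intro s hs hne
    have h1 : (s.1 : ℕ) + s.2 = n := by rw [← mem_pairsWithSum.1 hs]; rfl
    have h2 : (b : ℕ) ≤ s.2 := by
      by_contra hlt
      have := s.2.pos
      exact hne (by rw [Nat.choose_eq_zero_of_lt (by omega)]; simp)
    rw [show (b : ℕ) + (s.2 - b) = s.2 by omega, show (a : ℕ) - (s.2 - b) = s.1 by omega,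
      ← Nat.choose_symm (show (b : ℕ) - 1 ≤ s.2 - 1 by omega),
      show (s.2 : ℕ) - 1 - (b - 1) = s.2 - b by omega]

end PartialFractions

/-! ### Sums of reciprocals over a line -/

section Line

variable (F : Type*) [Field F] [Fintype F] {R : Type*} [CommRing R] [Algebra F R]

/-- X^q - X is the product of all X + θ, and its derivative is -1 because q = 0 in `F`. -/
theorem prod_add_algebraMap [DecidableEq F] (a : R) :
    ∏ θ : F, (a + algebraMap F R θ) = a ^ Fintype.card F - a ∧
      ∑ θ : F, ∏ φ ∈ Finset.univ.erase θ, (a + algebraMap F R φ) = -1 := by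
  have h1 : ∏ θ : F, (Polynomial.X + Polynomial.C θ)
      = (Polynomial.X ^ Fintype.card F - Polynomial.X : Polynomial F) := by
    have hq : 1 < Fintype.card F := Fintype.one_lt_card
    have hm : (Polynomial.X ^ Fintype.card F - Polynomial.X : Polynomial F).Monic :=
      Polynomial.monic_X_pow_sub (by simpa using hq)
    have := Polynomial.prod_multiset_X_sub_C_of_monic_of_roots_card_eq hm (by
      rw [FiniteField.roots_X_pow_card_sub_X, FiniteField.X_pow_card_sub_X_natDegree_eq F hq]
      rfl)
    rw [FiniteField.roots_X_pow_card_sub_X] at this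
    rw [← this]
    refine (Fintype.prod_equiv (Equiv.neg F) _ _ fun x => ?_)
    simp
  have h2 := congrArg Polynomial.derivative h1
  rw [Polynomial.derivative_prod_finset, Polynomial.derivative_sub, Polynomial.derivative_X_pow,
    FiniteField.cast_card_eq_zero] at h2
  constructor
  · simpa [map_prod] using congrArg (Polynomial.aeval a) h1
  · simpa [map_sum, map_prod] using congrArg (Polynomial.aeval a) h2

/-- This is the logarithmic derivative of ∏ (T + θ) = T^q - T at T = A b', with denominators
cleared. No denominator needs to be a unit, which matters for power series without constant term. -/
theorem sum_mul_sub_pow_card {A b b' x : R} (hb : b' * b = 1) (H : F → R)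
    (hH : ∀ θ, H θ * (A + algebraMap F R θ * b) = x) :
    (∑ θ, H θ) * (A - b' ^ (Fintype.card F - 1) * A ^ Fintype.card F) = x := by
  classical
  obtain ⟨h1, h2⟩ := prod_add_algebraMap F (A * b')
  have hq : 0 < Fintype.card F := Fintype.card_pos
  have e : A - b' ^ (Fintype.card F - 1) * A ^ Fintype.card F
      = - b * ((A * b') ^ Fintype.card F - A * b') := by
    obtain ⟨m, hm⟩ : ∃ m, Fintype.card F = m + 1 := ⟨_, (Nat.sub_add_cancel hq).symm⟩
    rw [hm, Nat.add_sub_cancel]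
    linear_combination (b' ^ m * A ^ (m + 1) - A) * hb
  have hH' : ∀ θ, H θ * (A * b' + algebraMap F R θ) = x * b' := by
    intro θ
    linear_combination b' * hH θ - H θ * algebraMap F R θ * hb
  have h3 : (∑ θ, H θ) * ∏ θ : F, (A * b' + algebraMap F R θ) = - (x * b') := by
    rw [Finset.sum_mul, ← mul_neg_one (x * b'), ← h2, Finset.mul_sum]
    refine Finset.sum_congr rfl fun θ _ => ?_
    rw [← Finset.mul_prod_erase _ _ (Finset.mem_univ θ), ← mul_assoc, hH']
  rw [e, ← h1]
  linear_combination (-b) * h3 + x * hb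

end Line

/-! ### Power sums over flags

A flag of finite subspaces of a field extension `K` of `F` is given by a list `c` of elements of
`K`, the last element being the first generator. -/

section Flag

variable (F : Type*) {K : Type*} [Field F] [Fintype F] [Field K] [Algebra F K]

/-- The normalized additive polynomial with set of zeros the span of `c`, as an `F`-linear map. -/
def flagMap : List K → K →ₗ[F] K
  | [] => LinearMap.id
  | t :: c => flagMap c - ((flagMap c t)⁻¹ ^ (Fintype.card F - 1)) •
      ((FiniteField.frobeniusAlgHom F K).toLinearMap ∘ₗ flagMap c)

/-- The normalized additive polynomial with set of zeros the span of `c`, as a power series. -/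
def flagSeries : List K → PowerSeries K
  | [] => PowerSeries.X
  | t :: c => flagSeries c - PowerSeries.C (flagMap F c t)⁻¹ ^ (Fintype.card F - 1) *
      flagSeries c ^ Fintype.card F

/-- The list `c` is linearly independent over `F`. -/
def IsFlag : List K → Prop
  | [] => True
  | t :: c => flagMap F c t ≠ 0 ∧ IsFlag c

/-- The power sum `∑ (z + v)⁻ⁿ`, where `v` runs through the span of `c`. -/
def powerSum : List K → K → ℕ → K
  | [], z, n => (z ^ n)⁻¹
  | t :: c, z, n => ∑ θ : F, powerSum c (z + θ • t) n

/-- The sum of the power sums over the steps of the flag `c`. -/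
def letterSum : List K → ℕ → K
  | [], _ => 0
  | t :: c, n => letterSum c n + powerSum F c t n

/-- The generating series of the power sums. -/
def powerSumSeries (c : List K) (z : K) : PowerSeries K :=
  PowerSeries.mk fun n => if n = 0 then 0 else powerSum F c z n

theorem flagMap_cons (t : K) (c : List K) (z : K) :
    flagMap F (t :: c) z = flagMap F c z
      - (flagMap F c t)⁻¹ ^ (Fintype.card F - 1) * flagMap F c z ^ Fintype.card F := by
  simp [flagMap]

theorem flagMap_of_mem {c : List K} {t : K} (h : t ∈ c) : flagMap F c t = 0 := by
  induction c with
  | nil => simp at h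
  | cons s c ih =>
    rw [flagMap_cons]
    have hq : Fintype.card F ≠ 0 := Fintype.card_ne_zero
    rcases List.mem_cons.1 h with rfl | h
    · by_cases h0 : flagMap F c t = 0
      · simp [h0]
      · obtain ⟨m, hm⟩ := Nat.exists_eq_succ_of_ne_zero hq
        rw [hm, Nat.succ_sub_one, pow_succ, ← mul_assoc, ← mul_pow, inv_mul_cancel₀ h0, one_pow,
          one_mul, sub_self]
    · simp [ih h]

/-- Dividing by the span of `c' ++ c` can be done in two stages: first by `c`, then by the image of
`c'`. -/
theorem flagMap_append (c' c : List K) (z : K) :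
    flagMap F (c' ++ c) z = flagMap F (c'.map (flagMap F c)) (flagMap F c z) := by
  induction c' generalizing z with
  | nil => rfl
  | cons t c' ih => rw [List.cons_append, List.map_cons, flagMap_cons, flagMap_cons, ih, ih]

theorem isFlag_append (c' c : List K) :
    IsFlag F (c' ++ c) ↔ IsFlag F (c'.map (flagMap F c)) ∧ IsFlag F c := by
  induction c' with
  | nil => simp [IsFlag]
  | cons t c' ih =>
    simp only [List.cons_append, List.map_cons, IsFlag, ih, flagMap_append, and_assoc]

theorem flagMap_add_smul_ne_zero {t : K} {c : List K} {z : K} (h : flagMap F (t :: c) z ≠ 0)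
    (θ : F) : flagMap F c (z + θ • t) ≠ 0 := by
  intro h0
  apply h
  have h1 : flagMap F (t :: c) (z + θ • t) = 0 := by
    rw [flagMap_cons, h0, zero_pow Fintype.card_ne_zero, mul_zero, sub_zero]
  rwa [map_add, map_smul, flagMap_of_mem F List.mem_cons_self, smul_zero, add_zero] at h1

/-! ### Generating series of the power sums. -/

theorem powerSumSeries_cons (t : K) (c : List K) (z : K) :
    powerSumSeries F (t :: c) z = ∑ θ : F, powerSumSeries F c (z + θ • t) := by
  ext n
  by_cases hn : n = 0 <;> simp [powerSumSeries, powerSum, hn, map_sum]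

/-- The series is ∑ X/(z + v - X), that is, X times the logarithmic derivative of e_c at z - X.
Since e_c is additive with derivative 1, this is X/(e_c(z) - e_c(X)). A new generator is absorbed by
`sum_mul_sub_pow_card`. -/
theorem powerSumSeries_mul_sub {c : List K} (hc : IsFlag F c) {z : K} (hz : flagMap F c z ≠ 0) :
    powerSumSeries F c z * (PowerSeries.C (flagMap F c z) - flagSeries F c) = PowerSeries.X := by
  induction c generalizing z with
  | nil =>
    have hz' : z ≠ 0 := hz
    ext n
    change PowerSeries.coeff n (powerSumSeries F [] z * (PowerSeries.C z - PowerSeries.X)) = _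
    rw [mul_sub, map_sub, PowerSeries.coeff_mul_C]
    rcases n with _ | _ | n
    · simp [powerSumSeries]
    · simp [powerSumSeries, powerSum, PowerSeries.coeff_succ_mul_X, hz']
    · rw [PowerSeries.coeff_succ_mul_X]
      simp [powerSumSeries, powerSum, PowerSeries.coeff_X]
      field_simp
      ring
  | cons t c ih =>
    have hb : PowerSeries.C (flagMap F c t)⁻¹ * PowerSeries.C (flagMap F c t) = 1 := by
      rw [← map_mul, inv_mul_cancel₀ hc.1, map_one]
    have key := sum_mul_sub_pow_card F
      (A := PowerSeries.C (flagMap F c z) - flagSeries F c) hb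
      (fun θ => powerSumSeries F c (z + θ • t)) (x := PowerSeries.X) (fun θ => by
        rw [← ih hc.2 (flagMap_add_smul_ne_zero F hz θ), map_add, map_smul, map_add,
          Algebra.smul_def θ (flagMap F c t), map_mul, PowerSeries.algebraMap_apply]
        ring)
    rw [powerSumSeries_cons, ← key, flagMap_cons]
    congr 1
    have hf := map_sub (FiniteField.frobeniusAlgHom F (PowerSeries K))
      (PowerSeries.C (flagMap F c z)) (flagSeries F c)
    simp only [FiniteField.frobeniusAlgHom_apply] at hf
    rw [hf, flagSeries, map_sub, map_mul, map_pow, map_pow]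
    ring

/-- At z = 0 the vector v = 0 contributes nothing, because 0⁻¹ = 0, whereas the formula of
`powerSumSeries_mul_sub` would count X/(0 - X) = -1 for it. This is the correction by 1. -/
theorem one_sub_powerSumSeries_mul {c : List K} (hc : IsFlag F c) :
    (1 - powerSumSeries F c 0) * flagSeries F c = PowerSeries.X := by
  induction c with
  | nil =>
    have : powerSumSeries F ([] : List K) 0 = 0 := by
      ext n
      by_cases hn : n = 0 <;> simp [powerSumSeries, powerSum, hn]
    rw [this, sub_zero, one_mul, flagSeries]
  | cons t c ih =>
    classical
    have hb : PowerSeries.C (flagMap F c t)⁻¹ * PowerSeries.C (flagMap F c t) = 1 := by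
      rw [← map_mul, inv_mul_cancel₀ hc.1, map_one]
    have key := sum_mul_sub_pow_card F (A := flagSeries F c) hb
      -- The sign in `-θ` comes from e_c(X) + θ e_c(t) = -(e_c(-θt) - e_c(X)). Only θ = 0 meets the
      -- zero vector and needs the correction.
      (fun θ => (if θ = 0 then 1 else 0) - powerSumSeries F c (0 + (-θ) • t))
      (x := PowerSeries.X) (fun θ => by
        by_cases hθ : θ = 0
        · simpa [hθ] using ih hc.2
        · have h0 : flagMap F c (0 + (-θ) • t) ≠ 0 := by
            rw [zero_add, map_smul]
            exact smul_ne_zero (neg_ne_zero.2 hθ) hc.1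
          rw [if_neg hθ, ← powerSumSeries_mul_sub F hc.2 h0, zero_add, map_smul,
            Algebra.smul_def _ (flagMap F c t), map_mul, PowerSeries.algebraMap_apply, map_neg,
            map_neg]
          ring)
    rw [flagSeries, ← key, powerSumSeries_cons, Finset.sum_sub_distrib]
    congr 2
    · simp
    · exact (Fintype.sum_equiv (Equiv.neg F) _ _ fun θ => by simp)

/-! ### Homogeneity and power sums at zero. -/

theorem powerSum_smul {θ : F} (hθ : θ ≠ 0) (c : List K) (z : K) (n : ℕ) :
    powerSum F c (θ • z) n = (θ ^ n)⁻¹ • powerSum F c z n := by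
  induction c generalizing z with
  | nil => simp [powerSum, Algebra.smul_def, mul_pow, mul_comm]
  | cons t c ih =>
    simp only [powerSum, Finset.smul_sum]
    refine (Fintype.sum_equiv (Equiv.mulLeft₀ θ hθ) _ _ fun φ => ?_).symm
    rw [← ih, smul_add, smul_smul]
    rfl

theorem sum_erase_inv_pow [DecidableEq F] (n : ℕ) :
    ∑ θ ∈ Finset.univ.erase (0 : F), (θ ^ n)⁻¹ = if Fintype.card F - 1 ∣ n then -1 else 0 := by
  rw [← FiniteField.sum_pow_units F n]
  symm
  refine Finset.sum_bij (fun x _ => ((x⁻¹ : Fˣ) : F)) ?_ ?_ ?_ ?_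
  · simp
  · intro x _ y _ h
    exact inv_injective (Units.ext h)
  · intro θ hθ
    refine ⟨(Units.mk0 θ (Finset.ne_of_mem_erase hθ))⁻¹, Finset.mem_univ _, ?_⟩
    simp
  · intro x _
    simp

/-- A nonzero vector of the span is a scalar θ times one with leading coefficient 1, and ∑ θ⁻ⁿ is -1
or 0 according to whether q - 1 divides n. This is the source of the divisibility condition in
`delta`. -/
theorem powerSum_zero_eq (c : List K) {n : ℕ} (hn : n ≠ 0) :
    powerSum F c 0 n = if Fintype.card F - 1 ∣ n then - letterSum F c n else 0 := by
  classical
  induction c with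
  | nil => simp [powerSum, letterSum, hn]
  | cons t c ih =>
    have h : powerSum F (t :: c) 0 n = powerSum F c 0 n
        + (∑ θ ∈ Finset.univ.erase (0 : F), (θ ^ n)⁻¹) • powerSum F c t n := by
      rw [powerSum, ← Finset.add_sum_erase _ _ (Finset.mem_univ (0 : F)), Finset.sum_smul]
      congr 1
      · simp
      · refine Finset.sum_congr rfl fun θ hθ => ?_
        rw [zero_add, powerSum_smul F (Finset.ne_of_mem_erase hθ)]
    rw [h, ih, sum_erase_inv_pow, letterSum]
    split_ifs <;> simp [add_comm]

/-! ### Power sums as sums over vectors, and Chen's formula. -/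

theorem powerSum_eq_sum (c : List K) (z : K) (n : ℕ) :
    powerSum F c z n
      = ∑ v : Fin c.length → F, ((z + ∑ i, v i • c.get i) ^ n)⁻¹ := by
  induction c generalizing z with
  | nil => simp [powerSum]
  | cons t c ih =>
    rw [powerSum]
    simp only [ih]
    rw [← Fintype.sum_prod_type']
    refine Fintype.sum_equiv (Fin.consEquiv fun _ => F) _ _ fun v => ?_
    simp [Fin.sum_univ_succ, add_assoc]

theorem flagMap_sum_smul (c : List K) (v : Fin c.length → F) :
    flagMap F c (∑ i, v i • c.get i) = 0 := by
  rw [map_sum]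
  refine Finset.sum_eq_zero fun i _ => ?_
  rw [map_smul, flagMap_of_mem F (List.get_mem c i), smul_zero]

/-- Applying `flagMap F c` kills all generators but the top one, so the top coefficient of a
vanishing combination is 0. -/
theorem sum_smul_injective {c : List K} (hc : IsFlag F c) :
    Function.Injective fun v : Fin c.length → F => ∑ i, v i • c.get i := by
  have key : ∀ v : Fin c.length → F, ∑ i, v i • c.get i = 0 → v = 0 := by
    induction c with
    | nil => exact fun v _ => funext fun i => i.elim0
    | cons t c ih =>
      intro v hv
      replace hv : v 0 • t + ∑ i : Fin c.length, v i.succ • c.get i = 0 :=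
        (Fin.sum_univ_succ (n := c.length) _).symm.trans hv
      have h1 := congrArg (flagMap F c) hv
      have h2 := flagMap_sum_smul F c fun i => v i.succ
      rw [map_add, map_smul, map_zero, h2, add_zero] at h1
      have h0 : v 0 = 0 := (smul_eq_zero.1 h1).resolve_right hc.1
      have h3 := ih hc.2 (fun i => v i.succ) (by simpa [h0] using hv)
      funext i
      refine Fin.cases h0 (fun i => congrFun h3 i) i
  intro v w h
  rw [← sub_eq_zero]
  refine key _ ?_
  simp only [Pi.sub_apply, sub_smul, Finset.sum_sub_distrib]
  exact sub_eq_zero.2 h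

theorem algebraMap_delta (a b j : ℕ) (ha : a ≠ 0) (hb : b ≠ 0) :
    (algebraMap F K (delta F a b j)) = if Fintype.card F - 1 ∣ j then
      -((-1) ^ a * ((j - 1).choose (a - 1) : K)) - (-1) ^ b * ((j - 1).choose (b - 1) : K)
      else 0 := by
  obtain ⟨a, rfl⟩ := Nat.exists_eq_succ_of_ne_zero ha
  obtain ⟨b, rfl⟩ := Nat.exists_eq_succ_of_ne_zero hb
  unfold delta
  rw [Nat.card_eq_fintype_card]
  split_ifs
  · simp [pow_succ]
  · simp

/-- Chen's formula for the product of two power sums. -/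
theorem powerSum_mul_powerSum {c : List K} (hc : IsFlag F c) {z : K} (hz : flagMap F c z ≠ 0)
    (a b : ℕ+) :
    powerSum F c z a * powerSum F c z b = powerSum F c z (a + b)
      + ∑ s ∈ pairsWithSum (a + b), algebraMap F K (delta F a b s.2) *
          (powerSum F c z s.1 * letterSum F c s.2) := by
  classical
  set L : (Fin c.length → F) → K := fun v => ∑ i, v i • c.get i with hL
  have hLsub : ∀ v w, L (v - w) = L v - L w := by
    intro v w
    simp [hL, sub_smul, Finset.sum_sub_distrib]
  have hne : ∀ v, z + L v ≠ 0 := by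
    intro v h
    apply hz
    have := congrArg (flagMap F c) h
    rwa [map_add, flagMap_sum_smul, add_zero, map_zero] at this
  have hz' : ∀ y n, powerSum F c y n = ∑ v, ((y + L v)⁻¹) ^ n := by
    intro y n
    rw [powerSum_eq_sum]
    simp only [inv_pow, hL]
  have hab : (a : ℕ) + b ≠ 0 := by have := a.pos; omega
  -- the polar parts at `v` and at `w`
  have hpair : ∀ v w : Fin c.length → F,
      ((z + L v)⁻¹) ^ (a : ℕ) * ((z + L w)⁻¹) ^ (b : ℕ)
        = (if v = w then ((z + L v)⁻¹) ^ ((a : ℕ) + b) else 0)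
          + ((-1) ^ (b : ℕ) * polarPart (L (v - w))⁻¹ (z + L v)⁻¹ a b
            + (-1) ^ (a : ℕ) * polarPart (L (w - v))⁻¹ (z + L w)⁻¹ b a) := by
    intro v w
    -- On the diagonal the inverse of `L (v - w) = 0` is 0, so both polar parts vanish and one
    -- formula covers all pairs.
    by_cases hvw : v = w
    · have hg : L (v - w) = 0 := by rw [hLsub, hvw, sub_self]
      have hg' : L (w - v) = 0 := by rw [hLsub, hvw, sub_self]
      have hpol : ∀ (p : K) (a b : ℕ+), polarPart (0 : K) p a b = 0 := by
        intro p a b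
        refine Finset.sum_eq_zero fun k _ => ?_
        rw [zero_pow (by have := b.pos; omega), mul_zero]
      rw [if_pos hvw, hg, hg', inv_zero, hpol, hpol, mul_zero, mul_zero, add_zero, add_zero, hvw,
        pow_add]
    · have hd : L v - L w ≠ 0 :=
        sub_ne_zero.2 fun h => hvw (sum_smul_injective F hc h)
      have hv := hne v
      have hw := hne w
      have hg' : (L (w - v))⁻¹ = - (L (v - w))⁻¹ := by
        rw [← inv_neg, hLsub, hLsub, neg_sub]
      have hrel : (z + L v)⁻¹ * (z + L w)⁻¹
          = (L (v - w))⁻¹ * ((z + L w)⁻¹ - (z + L v)⁻¹) := by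
        rw [hLsub]
        field_simp
        ring
      rw [if_neg hvw, zero_add, hg', partial_fractions hrel _ _ hab]
  have hL0 : ∀ n : ℕ, ∑ v, ((L v)⁻¹) ^ n = powerSum F c 0 n := fun n => by simp [hz']
  -- For fixed v the difference of v and w runs through the whole span, so the double sum factors
  -- into a power sum at z and one at 0.
  have hpol : ∀ (f : (Fin c.length → F) → (Fin c.length → F) → K) (a b n : ℕ+), a + b = n →
      (∀ g : K → K → K, ∑ v, ∑ w, g (f v w) (z + L v)⁻¹
        = ∑ v, ∑ w, g (L w)⁻¹ (z + L v)⁻¹) →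
      ∑ v, ∑ w, polarPart (f v w) (z + L v)⁻¹ a b
        = ∑ s ∈ pairsWithSum n, (((s.2 : ℕ) - 1).choose ((b : ℕ) - 1) : K) *
            (powerSum F c z s.1 * powerSum F c 0 s.2) := by
    intro f a b n h hf
    rw [hf (fun g p => polarPart g p a b)]
    simp only [polarPart_eq_sum _ _ a b n h]
    rw [Finset.sum_congr rfl fun v _ => Finset.sum_comm, Finset.sum_comm]
    refine Finset.sum_congr rfl fun s _ => ?_
    rw [← hL0, hz', Finset.sum_mul_sum, Finset.mul_sum]
    refine Finset.sum_congr rfl fun v _ => ?_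
    rw [Finset.mul_sum]
    refine Finset.sum_congr rfl fun w _ => ?_
    rw [mul_assoc]
  rw [hz', hz', Finset.sum_mul_sum]
  simp only [hpair, Finset.sum_add_distrib, ← Finset.mul_sum]
  have hdiag : ∑ v, ∑ w, (if v = w then ((z + L v)⁻¹) ^ ((a : ℕ) + b) else 0)
      = powerSum F c z (a + b) := by
    rw [hz']
    simp
  have hsub : ∀ (v : Fin c.length → F) (g : K → K → K),
      ∑ w, g (L (v - w))⁻¹ (z + L v)⁻¹ = ∑ w, g (L w)⁻¹ (z + L v)⁻¹ := fun v g =>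
    Fintype.sum_equiv (Equiv.subLeft v) _ _ fun w => rfl
  rw [hdiag, hpol (fun v w => (L (v - w))⁻¹) a b (a + b) rfl
    fun g => Finset.sum_congr rfl fun v _ => hsub v g, Finset.sum_comm,
    hpol (fun v w => (L (v - w))⁻¹) b a (a + b) (add_comm _ _)
    fun g => Finset.sum_congr rfl fun v _ => hsub v g, Finset.mul_sum, Finset.mul_sum,
    ← Finset.sum_add_distrib]
  congr 1
  refine Finset.sum_congr rfl fun s _ => ?_
  rw [algebraMap_delta F _ _ _ a.ne_zero b.ne_zero, powerSum_zero_eq F c s.2.ne_zero]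
  split_ifs <;> ring

end Flag

/-! ### Expansion of power sums over a flag in the additive polynomial -/

section Expansion

theorem one_sub_mul_sum_choose {R : Type*} [CommRing R] (W : R) (r M : ℕ) :
    (1 - W) * ∑ m ∈ Finset.range (M + 1), ((r + m).choose m : R) * W ^ m
      = ∑ m ∈ Finset.range (M + 1), ((r + m - 1).choose m : R) * W ^ m
        - ((r + M).choose M : R) * W ^ (M + 1) := by
  induction M with
  | zero => simp
  | succ M ih =>
    rw [Finset.sum_range_succ, mul_add, ih, Finset.sum_range_succ _ (M + 1)]
    have h : (r + (M + 1)).choose (M + 1) = (r + M).choose M + (r + M).choose (M + 1) :=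
      Nat.choose_succ_succ _ _
    rw [show r + (M + 1) - 1 = r + M by omega, h]
    push_cast
    ring

/-- This is the binomial series of (1 - W)⁻ʳ modulo W^(M+1). Each factor 1 - W lowers r by one, up
to a multiple of W^(M+1). -/
theorem pow_dvd_one_sub_mul_sum_choose {R : Type*} [CommRing R] (W : R) (r M : ℕ) :
    W ^ (M + 1) ∣ 1 - (1 - W) ^ r *
      ∑ m ∈ Finset.range (M + 1), ((r + m - 1).choose m : R) * W ^ m := by
  induction r with
  | zero =>
    rw [Finset.sum_range_succ', Finset.sum_eq_zero]
    · simp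
    · intro m _
      simp
  | succ r ih =>
    have h := one_sub_mul_sum_choose W r M
    have e : ∀ m, r + 1 + m - 1 = r + m := fun m => by omega
    simp only [e]
    rw [pow_succ _ r, mul_assoc, h, mul_sub, ← sub_add]
    exact dvd_add ih (Dvd.intro_left _ (mul_assoc _ _ _))

/-- The finite set of words over `Σ` of weight `n`. -/
def wordsOfWeight (n : ℕ) : Finset (List ℕ+) := (finite_sigmaWeight_eq n).toFinset

theorem mem_wordsOfWeight {n : ℕ} {l : List ℕ+} : l ∈ wordsOfWeight n ↔ sigmaWeight l = n := by
  simp [wordsOfWeight]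

theorem mem_splittings {n : ℕ} {p : ℕ+ × List ℕ+} :
    p ∈ splittings n ↔ (p.1 : ℕ) + sigmaWeight p.2 = n := by
  simp [splittings]

theorem sigmaWeight_cons (i : ℕ+) (l : List ℕ+) : sigmaWeight (i :: l) = i + sigmaWeight l := by
  simp [sigmaWeight]

theorem length_le_sigmaWeight (l : List ℕ+) : l.length ≤ sigmaWeight l := by
  induction l with
  | nil => simp
  | cons i l ih =>
    rw [sigmaWeight_cons, List.length_cons]
    have := i.pos
    omega

variable {M : Type*} [AddCommMonoid M]

theorem sum_splittings (n : ℕ) (f : ℕ → List ℕ+ → M) (hf : ∀ l, f 0 l = 0) :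
    ∑ p ∈ splittings n, f p.1 p.2
      = ∑ s ∈ Finset.HasAntidiagonal.antidiagonal n, ∑ l ∈ wordsOfWeight s.2, f s.1 l := by
  rw [Finset.sum_sigma']
  refine Finset.sum_bij_ne_zero (fun p _ _ => ⟨((p.1 : ℕ), sigmaWeight p.2), p.2⟩) ?_ ?_ ?_ ?_
  · intro p hp _
    simpa [mem_wordsOfWeight] using mem_splittings.1 hp
  · intro p _ _ p' _ _ h
    simp only [Sigma.mk.injEq, Prod.mk.injEq, heq_eq_eq] at h
    exact Prod.ext (PNat.coe_injective h.1.1) h.2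
  · rintro ⟨⟨i, j⟩, l⟩ h hne
    simp only [Finset.mem_sigma, Finset.HasAntidiagonal.mem_antidiagonal, mem_wordsOfWeight] at h
    have hi : 0 < i := by
      rcases Nat.eq_zero_or_pos i with rfl | hi
      · exact absurd (hf l) hne
      · exact hi
    refine ⟨(⟨i, hi⟩, l), mem_splittings.2 (by rw [h.2]; exact h.1), hne, ?_⟩
    simp [h.2]
  · intro p _ _
    rfl

theorem sum_wordsOfWeight (n : ℕ) (g : List ℕ+ → M) (hg : g [] = 0) :
    ∑ l ∈ wordsOfWeight n, g l = ∑ p ∈ splittings n, g (p.1 :: p.2) := by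
  symm
  refine Finset.sum_bij_ne_zero (fun p _ _ => p.1 :: p.2) ?_ ?_ ?_ ?_
  · intro p hp _
    rw [mem_wordsOfWeight, sigmaWeight_cons]
    exact mem_splittings.1 hp
  · intro p _ _ p' _ _ h
    exact Prod.ext (List.cons.inj h).1 (List.cons.inj h).2
  · rintro (_ | ⟨i, l⟩) h hne
    · exact absurd hg hne
    · refine ⟨(i, l), mem_splittings.2 ?_, hne, rfl⟩
      rw [mem_wordsOfWeight, sigmaWeight_cons] at h
      exact h
  · intro p _ _
    rfl

/-- A word of length m and weight k is a way to distribute the degree k over m factors. Every factor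
has positive degree because `W` has no constant term. -/
theorem coeff_pow_eq_sum_words {K : Type*} [CommRing K] (W : PowerSeries K)
    (h0 : PowerSeries.coeff 0 W = 0) (m k : ℕ) :
    PowerSeries.coeff k (W ^ m) = ∑ l ∈ wordsOfWeight k,
      if l.length = m then (l.map fun i : ℕ+ => PowerSeries.coeff (i : ℕ) W).prod else 0 := by
  induction m generalizing k with
  | zero =>
    rw [pow_zero, PowerSeries.coeff_one]
    have : ∀ l ∈ wordsOfWeight k, (if l.length = 0 then
        (l.map fun i : ℕ+ => PowerSeries.coeff (i : ℕ) W).prod else 0) = if l = [] then 1 else 0 := by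
      intro l _
      simp only [List.length_eq_zero_iff]
      split_ifs with h
      · simp [h]
      · rfl
    rw [Finset.sum_congr rfl this, Finset.sum_ite_eq']
    simp [mem_wordsOfWeight, sigmaWeight, eq_comm]
  | succ m ih =>
    rw [sum_wordsOfWeight _ _ (by simp), pow_succ', PowerSeries.coeff_mul]
    have := sum_splittings k (fun i l => PowerSeries.coeff i W * if l.length = m then
      (l.map fun i : ℕ+ => PowerSeries.coeff (i : ℕ) W).prod else 0) (by simp [h0])
    simp only [← Finset.mul_sum, ← ih] at this
    rw [← this]
    refine Finset.sum_congr rfl fun p _ => ?_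
    simp

theorem sum_length_wordsOfWeight {K : Type*} [CommRing K] (W : PowerSeries K)
    (h0 : PowerSeries.coeff 0 W = 0) (φ : ℕ → K) (k : ℕ) :
    ∑ l ∈ wordsOfWeight k, φ l.length * (l.map fun i : ℕ+ => PowerSeries.coeff (i : ℕ) W).prod
      = ∑ m ∈ Finset.range (k + 1), φ m * PowerSeries.coeff k (W ^ m) := by
  simp only [coeff_pow_eq_sum_words W h0, Finset.mul_sum]
  rw [Finset.sum_comm]
  refine Finset.sum_congr rfl fun l hl => ?_
  rw [Finset.sum_eq_single l.length]
  · simp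
  · intro m _ hm
    rw [if_neg hm.symm, mul_zero]
  · intro h
    have := length_le_sigmaWeight l
    rw [mem_wordsOfWeight.1 hl] at this
    exact absurd (Finset.mem_range.2 (by omega)) h

variable (F : Type*) {K : Type*} [Field F] [Fintype F] [Field K] [Algebra F K]

/-! ### Expansion of a power sum and its coefficients. -/

theorem coeff_zero_powerSumSeries (c : List K) (z : K) :
    PowerSeries.coeff 0 (powerSumSeries F c z) = 0 := by
  simp [powerSumSeries]

theorem coeff_powerSumSeries (c : List K) (z : K) (n : ℕ+) :
    PowerSeries.coeff n (powerSumSeries F c z) = powerSum F c z n := by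
  simp [powerSumSeries]

/-- The coefficients of the expansion of a power sum in powers of the inverse of the additive
polynomial. -/
def expansionCoeff (c : List K) (n r : ℕ) : K :=
  PowerSeries.coeff (n - r) ((1 - powerSumSeries F c 0)⁻¹ ^ (r - 1))

/-- With Y = 1 - `powerSumSeries F c 0` one has e_c(X) = X/Y, so the series at z is e⁻¹X/(1 - u)
with u = e⁻¹X/Y and e = e_c(z). The geometric series shows that e^(-r-1) comes with X^(r+1) Y^(-r).
-/
theorem powerSum_eq_sum_range {c : List K} (hc : IsFlag F c) {z : K} (hz : flagMap F c z ≠ 0)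
    {n : ℕ} (hn : n ≠ 0) :
    powerSum F c z n = ∑ r ∈ Finset.range n,
      expansionCoeff F c n (r + 1) * (flagMap F c z)⁻¹ ^ (r + 1) := by
  set G := powerSumSeries F c z with hG
  set e := flagMap F c z with he
  set Y := 1 - powerSumSeries F c 0 with hY
  have hY0 : PowerSeries.constantCoeff Y ≠ 0 := by
    rw [← PowerSeries.coeff_zero_eq_constantCoeff_apply, hY, map_sub, coeff_zero_powerSumSeries]
    simp
  have hP : flagSeries F c = PowerSeries.X * Y⁻¹ := by
    rw [← one_sub_powerSumSeries_mul F hc, mul_right_comm, ← hY, PowerSeries.mul_inv_cancel _ hY0,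
      one_mul]
  have h1 := powerSumSeries_mul_sub F hc hz
  rw [hP, ← hG, ← he] at h1
  have hee : (PowerSeries.C e * PowerSeries.C e⁻¹ : PowerSeries K) = 1 := by
    rw [← map_mul, mul_inv_cancel₀ hz, map_one]
  set u : PowerSeries K := PowerSeries.C e⁻¹ * (PowerSeries.X * Y⁻¹) with hu
  have h2 : G * (1 - u) = PowerSeries.C e⁻¹ * PowerSeries.X := by
    rw [← h1]
    linear_combination (-G) * hee
  have h3 : G = (∑ r ∈ Finset.range n, PowerSeries.C e⁻¹ * PowerSeries.X * u ^ r) + G * u ^ n := by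
    rw [← Finset.mul_sum, ← h2, mul_assoc, mul_neg_geom_sum]
    ring
  have h4 : PowerSeries.coeff n G = powerSum F c z n := by simp [hG, powerSumSeries, hn]
  rw [← h4, h3, map_add]
  -- `u ^ n` is divisible by Xⁿ and `G` has no constant term, so the remainder starts beyond degree
  -- n.
  have h5 : PowerSeries.coeff n (G * u ^ n) = 0 := by
    have : G * u ^ n = PowerSeries.X ^ n * (G * (PowerSeries.C e⁻¹ * Y⁻¹) ^ n) := by
      rw [hu]; ring
    rw [this, PowerSeries.coeff_X_pow_mul', if_pos le_rfl, Nat.sub_self,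
      PowerSeries.coeff_zero_eq_constantCoeff_apply, map_mul,
      ← PowerSeries.coeff_zero_eq_constantCoeff_apply, hG, coeff_zero_powerSumSeries, zero_mul]
  rw [h5, add_zero, map_sum]
  refine Finset.sum_congr rfl fun r hr => ?_
  have : PowerSeries.C e⁻¹ * PowerSeries.X * u ^ r
      = PowerSeries.C (e⁻¹ ^ (r + 1)) * (PowerSeries.X ^ (r + 1) * Y⁻¹ ^ r) := by
    rw [hu, map_pow]; ring
  rw [this, PowerSeries.coeff_C_mul, PowerSeries.coeff_X_pow_mul',
    if_pos (Nat.succ_le_of_lt (Finset.mem_range.1 hr)), mul_comm]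
  rfl

theorem expansionCoeff_self (c : List K) (n : ℕ) : expansionCoeff F c n n = 1 := by
  rw [expansionCoeff, Nat.sub_self, PowerSeries.coeff_zero_eq_constantCoeff_apply, map_pow,
    PowerSeries.constantCoeff_inv, map_sub, map_one,
    ← PowerSeries.coeff_zero_eq_constantCoeff_apply, coeff_zero_powerSumSeries]
  simp

/-- Expanding (1 - W)⁻ʳ for the series W of power sums at 0 yields the binomial coefficients of the
coproduct, with `r + 1` here in the role of r there. -/
theorem expansionCoeff_eq_sum (c : List K) (n r : ℕ) :
    expansionCoeff F c n (r + 1) = ∑ l ∈ wordsOfWeight (n - (r + 1)),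
      ((r + l.length - 1).choose l.length : K) * (l.map fun i : ℕ+ => powerSum F c 0 i).prod := by
  set W := powerSumSeries F c 0 with hW
  set k := n - (r + 1) with hk
  have hW0 := coeff_zero_powerSumSeries F c 0
  have h := sum_length_wordsOfWeight W hW0 (fun m => ((r + m - 1).choose m : K)) k
  simp only [hW, coeff_powerSumSeries] at h
  rw [h, ← hW]
  have hY0 : PowerSeries.constantCoeff (1 - W) ≠ 0 := by
    rw [← PowerSeries.coeff_zero_eq_constantCoeff_apply, map_sub, hW0]
    simp
  have hXW : PowerSeries.X ∣ W := PowerSeries.X_dvd_iff.2 (by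
    rwa [PowerSeries.coeff_zero_eq_constantCoeff_apply] at hW0)
  have hd := (pow_dvd_pow_of_dvd hXW (k + 1)).trans (pow_dvd_one_sub_mul_sum_choose W r k)
  have hd' := hd.mul_left ((1 - W)⁻¹ ^ r)
  rw [mul_sub, mul_one, ← mul_assoc, ← mul_pow, PowerSeries.inv_mul_cancel _ hY0, one_pow,
    one_mul] at hd'
  have := PowerSeries.X_pow_dvd_iff.1 hd' k (Nat.lt_succ_self k)
  rw [map_sub, sub_eq_zero] at this
  change PowerSeries.coeff k ((1 - W)⁻¹ ^ r) = _
  rw [this, map_sum]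
  refine Finset.sum_congr rfl fun m _ => ?_
  rw [← PowerSeries.coeff_C_mul, map_natCast]

/-- The integer and the truncated upper entry differ only at r = m = 0, which is the convention that
-1 over 0 equals 1. -/
theorem ring_choose_eq (r m : ℕ) :
    Ring.choose ((r + 1 : ℕ) + (m : ℤ) - 2) m = ((r + m - 1).choose m : ℤ) := by
  rcases Nat.eq_zero_or_pos (r + m) with h | h
  · obtain ⟨rfl, rfl⟩ : r = 0 ∧ m = 0 := by omega
    simp
  · have : ((r + 1 : ℕ) + (m : ℤ) - 2) = ((r + m - 1 : ℕ) : ℤ) := by omega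
    rw [this, Ring.choose_natCast]

theorem powerSum_eq_sum_splittings {c : List K} (hc : IsFlag F c) {z : K}
    (hz : flagMap F c z ≠ 0) {n : ℕ} (hn : n ≠ 0) :
    powerSum F c z n = ∑ p ∈ splittings n,
      ((Ring.choose ((p.1 : ℤ) + (p.2.length : ℤ) - 2) p.2.length : ℤ) : K) *
        ((p.2.map fun i : ℕ+ => powerSum F c 0 i).prod * (flagMap F c z)⁻¹ ^ (p.1 : ℕ)) := by
  have h := sum_splittings n (fun r l => if r = 0 then 0 else
    ((Ring.choose ((r : ℤ) + (l.length : ℤ) - 2) l.length : ℤ) : K) *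
        ((l.map fun i : ℕ+ => powerSum F c 0 i).prod * (flagMap F c z)⁻¹ ^ r)) (by simp)
  rw [powerSum_eq_sum_range F hc hz hn]
  simp only [PNat.ne_zero, if_false] at h
  rw [h, Finset.Nat.sum_antidiagonal_eq_sum_range_succ_mk, Finset.sum_range_succ']
  simp only [if_true, Finset.sum_const_zero, add_zero, Nat.add_eq_zero_iff, one_ne_zero, and_false,
    if_false]
  refine Finset.sum_congr rfl fun r _ => ?_
  rw [expansionCoeff_eq_sum, Finset.sum_mul]
  refine Finset.sum_congr rfl fun l _ => ?_
  rw [ring_choose_eq]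
  push_cast
  ring

end Expansion

/-! ### Evaluation of words at decorated flags -/

section Evaluation

theorem coe_list (l : List ℕ+) :
    (do let a ← l; pure (a : ℕ)) = l.map fun i : ℕ+ => (i : ℕ) := by
  induction l with
  | nil => rfl
  | cons i l ih => simpa using ih

theorem concat_singleton {F : Type u} [Field F] (y : Letter F) (v : WordAlgebra F) :
    concat (word [y]) v = cons y v := by
  have : concat (word [y]) = cons y := linExt_ext fun w => by simp [concat]
  rw [this]

/-- The flag underlying a decorated flag. -/
abbrev flagOf {K : Type*} (c : List (K × ℕ)) : List K := c.map Prod.fst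

theorem flagOf_append {K : Type*} (c' c : List (K × ℕ)) :
    flagOf (c' ++ c) = flagOf c' ++ flagOf c := by
  simp [flagOf]

variable {F : Type u} {K : Type u} [Field F] [Fintype F] [Field K] [Algebra F K]

/-- The expansion in 1/e_c has coefficients independent of the point. It can therefore be summed
over the translates of z by the span of `c'`, which `flagMap F c` turns into a power sum over the
image flag. -/
theorem powerSum_append {c : List K} (hc : IsFlag F c) (c' : List K) {z : K}
    (hz : flagMap F (c' ++ c) z ≠ 0) {n : ℕ} (hn : n ≠ 0) :
    powerSum F (c' ++ c) z n = ∑ p ∈ splittings n,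
      ((Ring.choose ((p.1 : ℤ) + (p.2.length : ℤ) - 2) p.2.length : ℤ) : K) *
        ((p.2.map fun i : ℕ+ => powerSum F c 0 i).prod *
          powerSum F (c'.map (flagMap F c)) (flagMap F c z) p.1) := by
  induction c' generalizing z with
  | nil =>
    rw [List.nil_append, powerSum_eq_sum_splittings F hc hz hn]
    simp only [List.map_nil, powerSum, inv_pow]
  | cons t c' ih =>
    rw [List.cons_append, powerSum,
      Finset.sum_congr rfl fun θ _ => ih (flagMap_add_smul_ne_zero F hz θ), Finset.sum_comm]
    refine Finset.sum_congr rfl fun p _ => ?_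
    rw [← Finset.mul_sum, ← Finset.mul_sum, List.map_cons, powerSum]
    simp only [map_add, map_smul]

/-- The contribution of the top step `ℓ` of a decorated flag for the letter `x`. -/
def stepSum (ℓ : K × ℕ) (c : List (K × ℕ)) (x : Letter F) : K :=
  algebraMap F K x.2 ^ ℓ.2 * powerSum F (flagOf c) ℓ.1 x.1

/-- The evaluation of a word at a decorated flag. -/
def evalWord : List (K × ℕ) → Word F → K
  | _, [] => 1
  | [], _ :: _ => 0
  | ℓ :: c, x :: w => evalWord c (x :: w) + stepSum ℓ c x * evalWord c w

/-- The evaluation of `𝔇` at a decorated flag. -/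
def evalLin (c : List (K × ℕ)) : WordAlgebra F →ₗ[F] K := linExt (evalWord c)

/-- The contribution to the evaluation of the top step of a decorated flag. -/
def topEval (ℓ : K × ℕ) (c : List (K × ℕ)) : WordAlgebra F →ₗ[F] K :=
  linExt fun
    | [] => 0
    | x :: w => stepSum ℓ c x * evalWord c w

theorem evalLin_word (c : List (K × ℕ)) (w : Word F) : evalLin c (word w) = evalWord c w :=
  linExt_word _ _

theorem evalWord_nil (c : List (K × ℕ)) : evalWord c ([] : Word F) = 1 := by
  cases c <;> rfl

theorem evalLin_nil (c : List (K × ℕ)) : evalLin c (word ([] : Word F)) = 1 := by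
  rw [evalLin_word, evalWord_nil]

theorem evalLin_nil_cons (x : Letter F) (v : WordAlgebra F) :
    evalLin ([] : List (K × ℕ)) (cons x v) = 0 := by
  have : evalLin ([] : List (K × ℕ)) ∘ₗ cons x = 0 := linExt_ext fun w => by
    rw [LinearMap.comp_apply, cons_word, evalLin_word]; rfl
  exact LinearMap.congr_fun this v

theorem evalLin_cons (ℓ : K × ℕ) (c : List (K × ℕ)) (v : WordAlgebra F) :
    evalLin (ℓ :: c) v = evalLin c v + topEval ℓ c v := by
  have : evalLin (ℓ :: c) = (evalLin c + topEval ℓ c : WordAlgebra F →ₗ[F] K) :=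
    linExt_ext fun w => by
      rw [LinearMap.add_apply, evalLin_word, evalLin_word, topEval, linExt_word]
      cases w with
      | nil => rw [evalWord_nil, evalWord_nil, add_zero]
      | cons x w => rfl
  exact LinearMap.congr_fun this v

theorem topEval_cons (ℓ : K × ℕ) (c : List (K × ℕ)) (x : Letter F) (v : WordAlgebra F) :
    topEval ℓ c (cons x v) = stepSum ℓ c x * evalLin c v := by
  have : topEval ℓ c ∘ₗ cons x = LinearMap.mulLeft F (stepSum ℓ c x) ∘ₗ evalLin c :=
    linExt_ext fun w => by
      rw [LinearMap.comp_apply, cons_word, topEval, linExt_word, LinearMap.comp_apply,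
        evalLin_word]
      rfl
  exact LinearMap.congr_fun this v

theorem evalLin_singleton (c : List (K × ℕ)) (n : ℕ+) :
    evalLin c (word [((n, 1) : Letter F)]) = letterSum F (flagOf c) n := by
  induction c with
  | nil => rw [← cons_word, evalLin_nil_cons]; rfl
  | cons ℓ c ih =>
    rw [evalLin_cons, ih, ← cons_word, topEval_cons, evalLin_nil, stepSum]
    simp [letterSum]

/-- Adding a top step ℓ changes the evaluation by `topEval ℓ c`. Expanding the product of two
evaluations at `ℓ :: c` gives four terms: neither word, either word or both words use ℓ. The last is
a product of two step sums, and Chen's formula makes it the diamond term. -/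
theorem evalLin_shuffle {c : List (K × ℕ)} (hc : IsFlag F (flagOf c)) (v w : WordAlgebra F) :
    evalLin c (shuffle v w) = evalLin c v * evalLin c w := by
  induction c generalizing v w with
  | nil =>
    have : (shuffle (F := F)).compr₂ (evalLin ([] : List (K × ℕ)))
        = (LinearMap.mul F K).compl₁₂ (evalLin []) (evalLin []) := by
      refine linExt_ext fun a => linExt_ext fun b => ?_
      simp only [LinearMap.compr₂_apply, LinearMap.compl₁₂_apply, LinearMap.mul_apply']
      cases a with
      | nil => rw [shuffle_word_nil_left, evalLin_nil, one_mul]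
      | cons x a =>
        cases b with
        | nil => rw [shuffle_word_nil_right, evalLin_nil, mul_one]
        | cons y b =>
          rw [shuffle_word_cons_word_cons, diamond_word_cons_word_cons, ← cons_word x a]
          simp [evalLin_nil_cons, -cons_word]
    exact LinearMap.congr_fun₂ this v w
  | cons ℓ c ih =>
    have ih' := ih hc.2
    have : (shuffle (F := F)).compr₂ (evalLin (ℓ :: c))
        = (LinearMap.mul F K).compl₁₂ (evalLin (ℓ :: c)) (evalLin (ℓ :: c)) := by
      refine linExt_ext fun a => linExt_ext fun b => ?_
      simp only [LinearMap.compr₂_apply, LinearMap.compl₁₂_apply, LinearMap.mul_apply']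
      cases a with
      | nil => rw [shuffle_word_nil_left, evalLin_nil, one_mul]
      | cons x a =>
        cases b with
        | nil => rw [shuffle_word_nil_right, evalLin_nil, mul_one]
        | cons y b =>
          have chen : stepSum ℓ c (x.1 + y.1, x.2 * y.2) + ∑ p ∈ pairsWithSum (x.1 + y.1),
              delta F x.1 y.1 p.2 • (stepSum ℓ c (p.1, x.2 * y.2) * letterSum F (flagOf c) p.2)
              = stepSum ℓ c x * stepSum ℓ c y := by
            have h := powerSum_mul_powerSum F hc.2 hc.1 x.1 y.1
            simp only [stepSum, Units.val_mul, map_mul, mul_pow, PNat.add_coe, Algebra.smul_def]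
            have e : ∀ A B C D : K, A * C * (B * D) = A * B * (C * D) := fun _ _ _ _ => by ring
            rw [e, h, mul_add, Finset.mul_sum]
            congr 1
            refine Finset.sum_congr rfl fun p _ => ?_
            ring
          have htop : topEval ℓ c (shuffle (word (x :: a)) (word (y :: b)))
              = stepSum ℓ c x * (evalLin c (word a) * evalLin c (word (y :: b)))
                + stepSum ℓ c y * (evalLin c (word (x :: a)) * evalLin c (word b))
                + stepSum ℓ c x * stepSum ℓ c y * (evalLin c (word a) * evalLin c (word b)) := by
            rw [shuffle_word_cons_word_cons, diamond_word_cons_word_cons, ← chen]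
            simp only [map_add, map_sum, map_smul, topEval_cons, ih', evalLin_singleton, add_mul,
              Finset.sum_mul]
            congr 2
            refine Finset.sum_congr rfl fun p _ => ?_
            rw [smul_mul_assoc, mul_assoc]
          rw [evalLin_cons, ih', htop, evalLin_cons, evalLin_cons, ← cons_word x, ← cons_word y,
            topEval_cons, topEval_cons]
          ring
    exact LinearMap.congr_fun₂ this v w

/-- For 1 ≤ i ≤ w the second binomial in Δ^i_{1,w+1} vanishes, so this coefficient is the indicator
of q - 1 dividing i. By `powerSum_zero_eq` each signed factor becomes a power sum at 0. -/
theorem evalLin_bracket {c : List (K × ℕ)} (hc : IsFlag F (flagOf c)) (l : List ℕ+) :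
    evalLin c (bracket F l) = (l.map fun i : ℕ+ => powerSum F (flagOf c) 0 i).prod := by
  have h1 : ∀ l : List ℕ+, evalLin c
      ((l.map fun i => word [((i, 1) : Letter F)]).foldr (fun v w => shuffle v w) (word []))
      = (l.map fun i : ℕ+ => letterSum F (flagOf c) i).prod := by
    intro l
    induction l with
    | nil => simp [evalLin_nil]
    | cons i l ih =>
      rw [List.map_cons, List.foldr_cons, evalLin_shuffle hc, ih, evalLin_singleton, List.map_cons,
        List.prod_cons]
  have h2 : ∀ i ∈ l, (i : ℕ) ≤ sigmaWeight l := by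
    intro i hi
    refine List.single_le_sum (by simp) _ ?_
    rw [coe_list]
    simpa using hi
  rw [bracket, coe_list, List.map_map, map_smul, h1, Algebra.smul_def]
  -- The weight is frozen, since it enters every factor; the induction on the word only needs the
  -- bounds i ≤ w.
  generalize sigmaWeight l = w at h2
  induction l with
  | nil => simp
  | cons i l ih =>
    have hd : algebraMap F K (delta F 1 (w + 1) i) = if Fintype.card F - 1 ∣ i then 1 else 0 := by
      rw [algebraMap_delta F _ _ _ one_ne_zero (Nat.succ_ne_zero w)]
      have h3 := h2 i List.mem_cons_self
      have hi := i.pos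
      rw [Nat.succ_sub_one, Nat.choose_eq_zero_of_lt (show (i : ℕ) - 1 < w by omega)]
      simp
    have hp : powerSum F (flagOf c) 0 i
        = -1 * algebraMap F K (delta F 1 (w + 1) i) * letterSum F (flagOf c) i := by
      rw [hd, powerSum_zero_eq F _ i.ne_zero]
      split_ifs <;> simp
    simp only [List.map_cons, List.prod_cons, List.length_cons]
    rw [hp, ← ih fun j hj => h2 j (List.mem_cons_of_mem _ hj)]
    simp only [map_mul, map_pow, map_neg, map_one, Function.comp_apply]
    ring

/-- The evaluation of `𝔇 ⊗ 𝔇` at a pair of decorated flags. -/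
def evalTensor (c' c : List (K × ℕ)) : WordAlgebra F ⊗[F] WordAlgebra F →ₗ[F] K :=
  LinearMap.mul' F K ∘ₗ TensorProduct.map (evalLin c') (evalLin c)

theorem evalTensor_tmul (c' c : List (K × ℕ)) (v w : WordAlgebra F) :
    evalTensor c' c (v ⊗ₜ[F] w) = evalLin c' v * evalLin c w := by
  simp [evalTensor]

theorem evalTensor_nil_map₂ (c : List (K × ℕ)) (x : Letter F)
    (t : WordAlgebra F ⊗[F] WordAlgebra F) :
    evalTensor [] c (TensorProduct.map₂ concat shuffle (letterTail x) t) = 0 := by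
  rw [letterTail, map_sum, LinearMap.sum_apply, map_sum]
  refine Finset.sum_eq_zero fun p _ => ?_
  rw [map_smul, LinearMap.smul_apply, map_smul]
  induction t with
  | zero => simp
  | add s t hs ht => rw [map_add, map_add, smul_add, hs, ht, add_zero]
  | tmul a b =>
    rw [TensorProduct.map₂_apply_tmul, TensorProduct.map_tmul, evalTensor_tmul, concat_singleton,
      evalLin_nil_cons,
      zero_mul, smul_zero]

theorem evalTensor_cons_map₂ {c : List (K × ℕ)} (hc : IsFlag F (flagOf c)) (ℓ : K × ℕ)
    (c' : List (K × ℕ)) (x : Letter F) (t : WordAlgebra F ⊗[F] WordAlgebra F) :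
    evalTensor (ℓ :: c') c (TensorProduct.map₂ concat shuffle (letterTail x) t)
      = evalTensor c' c (TensorProduct.map₂ concat shuffle (letterTail x) t)
        + (∑ p ∈ splittings x.1,
            ((Ring.choose ((p.1 : ℤ) + (p.2.length : ℤ) - 2) p.2.length : ℤ) : K) *
              ((p.2.map fun i : ℕ+ => powerSum F (flagOf c) 0 i).prod *
                stepSum ℓ c' ((p.1, x.2) : Letter F))) * evalTensor c' c t := by
  rw [letterTail, map_sum, LinearMap.sum_apply, map_sum, map_sum, Finset.sum_mul,
    ← Finset.sum_add_distrib]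
  refine Finset.sum_congr rfl fun p _ => ?_
  rw [map_smul, LinearMap.smul_apply, map_smul, map_smul, Algebra.smul_def, Algebra.smul_def,
    map_intCast, mul_assoc, ← mul_add]
  congr 1
  induction t with
  | zero => simp
  | add s t hs ht =>
    rw [map_add, map_add, hs, ht, map_add, map_add]
    ring
  | tmul a b =>
    rw [TensorProduct.map₂_apply_tmul, TensorProduct.map_tmul, evalTensor_tmul,
      evalTensor_tmul, evalTensor_tmul,
      concat_singleton, evalLin_cons, topEval_cons, evalLin_shuffle hc, evalLin_bracket hc]
    ring

/-- The image of a decorated flag modulo another one. -/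
def pushFlag (F : Type u) [Field F] [Fintype F] [Algebra F K] (c c' : List (K × ℕ)) :
    List (K × ℕ) :=
  c'.map fun ℓ => (flagMap F (flagOf c) ℓ.1, ℓ.2)

theorem flagOf_pushFlag (c c' : List (K × ℕ)) :
    flagOf (pushFlag F c c') = (flagOf c').map (flagMap F (flagOf c)) := by
  simp [pushFlag, flagOf]

/-- In a nested sum over `c' ++ c` an initial part of the word uses steps of `c'` and the rest uses
steps of `c`. By `powerSum_append` each letter on `c'` splits into letters on the image flag times
brackets evaluated at `c`, as in `letterTail`. -/
theorem evalTensor_comul (c' : List (K × ℕ)) {c : List (K × ℕ)}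
    (h : IsFlag F (flagOf (c' ++ c))) (v : WordAlgebra F) :
    evalTensor (pushFlag F c c') c (comul v) = evalLin (c' ++ c) v := by
  have key : ∀ w : Word F, evalTensor (pushFlag F c c') c (comul (word w))
      = evalLin (c' ++ c) (word w) := by
    induction c' with
    | nil =>
      rintro (_ | ⟨x, w⟩)
      · simp [comul, wordComul, evalTensor_tmul, evalLin_nil]
      · rw [comul_cons, map_add, evalTensor_tmul, evalLin_nil, one_mul, pushFlag, List.map_nil,
          evalTensor_nil_map₂, add_zero, List.nil_append]
    | cons ℓ c' ih =>
      have ih' := ih h.2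
      have hc : IsFlag F (flagOf c) := by
        rw [flagOf_append] at h
        exact ((isFlag_append F _ _).1 h).2
      rintro (_ | ⟨x, w⟩)
      · simp [comul, wordComul, evalTensor_tmul, evalLin_nil]
      · have h1 := ih' (x :: w)
        rw [comul_cons, map_add, evalTensor_tmul, evalLin_nil, one_mul] at h1
        rw [comul_cons, map_add, evalTensor_tmul, evalLin_nil, one_mul, pushFlag, List.map_cons,
          ← pushFlag, evalTensor_cons_map₂ hc, ih', ← add_assoc, h1, List.cons_append,
          evalLin_cons, ← cons_word, topEval_cons]
        congr 2
        have h2 := h.1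
        change flagMap F (flagOf (c' ++ c)) ℓ.1 ≠ 0 at h2
        simp only [stepSum, flagOf_pushFlag, flagOf_append] at h2 ⊢
        rw [powerSum_append hc _ h2 x.1.ne_zero, Finset.mul_sum]
        refine Finset.sum_congr rfl fun p _ => ?_
        ring
  have : evalTensor (pushFlag F c c') c ∘ₗ comul = evalLin (c' ++ c) := linExt_ext key
  exact LinearMap.congr_fun this v

end Evaluation

/-! ### Evaluations separate the elements of tensor powers of `𝔇` -/

section Separation

theorem linearIndependent_mul {K ι κ X Y : Type*} [Field K] {f : ι → X → K} {g : κ → Y → K}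
    (hf : LinearIndependent K f) (hg : LinearIndependent K g) :
    LinearIndependent K fun (p : ι × κ) (q : X × Y) => f p.1 q.1 * g p.2 q.2 := by
  classical
  rw [linearIndependent_iff'] at hf hg ⊢
  intro s l h
  have hmem : ∀ p ∈ s, p ∈ s.image Prod.fst ×ˢ s.image Prod.snd := fun p hp =>
    Finset.mem_product.2 ⟨Finset.mem_image_of_mem _ hp, Finset.mem_image_of_mem _ hp⟩
  set m : ι × κ → K := fun p => if p ∈ s then l p else 0 with hm
  have h1 : ∀ x y, ∑ i ∈ s.image Prod.fst, ∑ j ∈ s.image Prod.snd,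
      m (i, j) * (f i x * g j y) = 0 := by
    intro x y
    rw [← Finset.sum_product']
    have := congrFun h (x, y)
    rw [Finset.sum_apply] at this
    rw [← Finset.sum_subset (fun p hp => hmem p hp)
      (fun p _ hp => by simp [hm, hp])]
    refine Eq.trans (Finset.sum_congr rfl fun p hp => ?_) this
    simp [hm, hp]
  have h2 : ∀ x, ∀ j ∈ s.image Prod.snd, ∑ i ∈ s.image Prod.fst, m (i, j) * f i x = 0 := by
    intro x
    refine hg _ (fun j => ∑ i ∈ s.image Prod.fst, m (i, j) * f i x) ?_
    funext y
    rw [Finset.sum_apply, Pi.zero_apply, ← h1 x y, Finset.sum_comm]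
    refine Finset.sum_congr rfl fun j _ => ?_
    rw [Pi.smul_apply, smul_eq_mul, Finset.sum_mul]
    refine Finset.sum_congr rfl fun i _ => ?_
    ring
  intro p hp
  have hp' := Finset.mem_product.1 (hmem p hp)
  have h3 := hf _ (fun i => m (i, p.2)) (by
    funext x
    rw [Finset.sum_apply]
    exact h2 x p.2 hp'.2) p.1 hp'.1
  simpa [hm, hp] using h3

section Faithful

variable {F K V W ι κ X Y : Type*} [Field F] [Field K] [Algebra F K] [AddCommGroup V] [Module F V]
  [AddCommGroup W] [Module F W]

/-- The values of `v - w` form an `F`-combination of the independent rows with the coordinates of `v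
- w` as coefficients. -/
theorem eq_of_forall_eval_eq (b : Module.Basis ι F V) {e : X → V →ₗ[F] K}
    (h : LinearIndependent K fun i x => e x (b i)) {v w : V} (hvw : ∀ x, e x v = e x w) :
    v = w := by
  rw [← sub_eq_zero]
  have h0 : ∀ x, e x (v - w) = 0 := fun x => by rw [map_sub, hvw, sub_self]
  generalize v - w = u at h0
  have h' := linearIndependent_iff.1 (h.restrict_scalars' F)
  have : b.repr u = 0 := h' _ (by
    funext x
    rw [Pi.zero_apply, ← h0 x]
    conv_rhs => rw [← b.linearCombination_repr u]
    rw [Finsupp.linearCombination_apply, Finsupp.linearCombination_apply, Finsupp.sum,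
      Finsupp.sum, Finset.sum_apply, map_sum]
    refine Finset.sum_congr rfl fun i _ => ?_
    rw [Pi.smul_apply, map_smul])
  simpa using this

theorem linearIndependent_tensor (b : Module.Basis ι F V) (b' : Module.Basis κ F W)
    {e : X → V →ₗ[F] K} {e' : Y → W →ₗ[F] K}
    (h : LinearIndependent K fun i x => e x (b i))
    (h' : LinearIndependent K fun i x => e' x (b' i)) :
    LinearIndependent K fun (p : ι × κ) (q : X × Y) =>
      (LinearMap.mul' F K ∘ₗ TensorProduct.map (e q.1) (e' q.2)) (b.tensorProduct b' p) := by
  convert linearIndependent_mul h h' using 3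
  rw [Module.Basis.tensorProduct_apply']
  simp

end Faithful

/-- Dedekind independence of the characters k ↦ εᵏ of ℕ. This is why flags are decorated with
exponents: they separate letters of equal weight. -/
theorem linearIndependent_units_pow {F K : Type*} [Field F] [Field K] [Algebra F K] :
    LinearIndependent K fun (ε : Fˣ) (k : ℕ) => algebraMap F K ε ^ k := by
  have h := (linearIndependent_monoidHom (Multiplicative ℕ) K).comp
    (fun ε : Fˣ => powersHom K (algebraMap F K ε)) (by
      intro ε δ h
      have := DFunLike.congr_fun h (Multiplicative.ofAdd 1)
      simpa [Units.ext_iff] using this)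
  exact h

/-! ### Flags over an algebraically closed field and independence of the evaluations. -/

variable {F : Type u} {K : Type u} [Field F] [Fintype F] [Field K] [Algebra F K]

theorem flagMap_surjective [IsAlgClosed K] (c : List K) :
    Function.Surjective (flagMap F c) := by
  induction c with
  | nil => exact fun z => ⟨z, rfl⟩
  | cons t c ih =>
    intro y
    set β := (flagMap F c t)⁻¹ ^ (Fintype.card F - 1)
    have hq : 1 < Fintype.card F := Fintype.one_lt_card
    set p : Polynomial K := Polynomial.X - Polynomial.C β * Polynomial.X ^ Fintype.card F
      - Polynomial.C y with hp
    -- As q > 1, the linear coefficient is 1 even if `β = 0`, so `p` is not constant.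
    have h1 : p.coeff 1 = 1 := by
      simp [hp, Polynomial.coeff_X_pow, hq.ne]
    have hdeg : p.degree ≠ 0 := by
      intro h
      rw [Polynomial.eq_C_of_degree_eq_zero h, Polynomial.coeff_C, if_neg one_ne_zero] at h1
      exact zero_ne_one h1
    obtain ⟨x, hx⟩ := IsAlgClosed.exists_root p hdeg
    obtain ⟨z, rfl⟩ := ih x
    refine ⟨z, ?_⟩
    rw [flagMap_cons]
    change _ - β * _ = y
    simpa [hp, Polynomial.IsRoot, sub_eq_zero] using hx

variable (F K) in
/-- The decorated flags. -/
abbrev DecFlag : Type u := {c : List (K × ℕ) // IsFlag F (flagOf c)}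

/-- Surjectivity of `flagMap` lifts `c'`, so evaluations at all pairs of flags come from
concatenated flags, where `evalTensor_comul` applies. -/
theorem exists_pushFlag_eq [IsAlgClosed K] (c c' : DecFlag F K) :
    ∃ c'' : List (K × ℕ), pushFlag F c.1 c'' = c'.1 ∧ IsFlag F (flagOf (c'' ++ c.1)) := by
  have h1 : ∀ l : List (K × ℕ), ∃ l', pushFlag F c.1 l' = l := by
    intro l
    induction l with
    | nil => exact ⟨[], rfl⟩
    | cons ℓ l ih =>
      obtain ⟨l', rfl⟩ := ih
      obtain ⟨t, ht⟩ := flagMap_surjective (F := F) (flagOf c.1) ℓ.1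
      exact ⟨(t, ℓ.2) :: l', by simp [pushFlag, ht]⟩
  obtain ⟨c'', h⟩ := h1 c'.1
  refine ⟨c'', h, ?_⟩
  rw [flagOf_append, isFlag_append]
  refine ⟨?_, c.2⟩
  rw [← flagOf_pushFlag, h]
  exact c'.2

/-- The polynomial in the inverse of the additive polynomial that expresses a power sum. -/
def expansionPoly (F : Type*) {K : Type*} [Field F] [Fintype F] [Field K] [Algebra F K]
    (c : List K) (n : ℕ) : Polynomial K :=
  Polynomial.X ^ n + ∑ r ∈ Finset.range n,
    Polynomial.C (if r = 0 then 0 else expansionCoeff F c n r) * Polynomial.X ^ r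

theorem degree_expansionPoly (c : List K) (n : ℕ) : (expansionPoly F c n).degree = n := by
  have h : (∑ r ∈ Finset.range n,
      Polynomial.C (if r = 0 then 0 else expansionCoeff F c n r) * Polynomial.X ^ r).degree
        < (n : WithBot ℕ) := by
    refine (Polynomial.degree_lt_iff_coeff_zero _ _).2 fun m hm => ?_
    rw [Polynomial.finsetSum_coeff]
    refine Finset.sum_eq_zero fun r hr => ?_
    rw [Polynomial.coeff_C_mul_X_pow, if_neg]
    have := Finset.mem_range.1 hr
    omega
  rw [expansionPoly, Polynomial.degree_add_eq_left_of_degree_lt, Polynomial.degree_X_pow]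
  rwa [Polynomial.degree_X_pow]

theorem eval_expansionPoly {c : List K} (hc : IsFlag F c) {z : K} (hz : flagMap F c z ≠ 0)
    {n : ℕ} (hn : n ≠ 0) :
    (expansionPoly F c n).eval (flagMap F c z)⁻¹ = powerSum F c z n := by
  have h : (expansionPoly F c n).eval (flagMap F c z)⁻¹ = ∑ r ∈ Finset.range (n + 1),
      (if r = 0 then 0 else expansionCoeff F c n r) * (flagMap F c z)⁻¹ ^ r := by
    rw [Finset.sum_range_succ, if_neg hn, expansionCoeff_self, one_mul, add_comm, expansionPoly,
      Polynomial.eval_add, Polynomial.eval_finsetSum]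
    simp
  rw [h, Finset.sum_range_succ', powerSum_eq_sum_range F hc hz hn]
  simp

/-- The n-th power sum is a polynomial of degree n in 1/e_c(t), and 1/e_c(t) takes every nonzero
value of the infinite field `K`. -/
theorem linearIndependent_powerSum [IsAlgClosed K] {c : List K} (hc : IsFlag F c) :
    LinearIndependent K fun (n : ℕ+) (t : {t : K // flagMap F c t ≠ 0}) =>
      powerSum F c t.1 n := by
  let S : Polynomial.Sequence K := ⟨expansionPoly F c, degree_expansionPoly c⟩
  have h1 : LinearIndependent K fun n : ℕ+ => expansionPoly F c n :=
    S.linearIndependent.comp (fun n : ℕ+ => (n : ℕ)) PNat.coe_injective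
  let E : Polynomial K →ₗ[K] ({t : K // flagMap F c t ≠ 0} → K) :=
    LinearMap.pi fun t => Polynomial.leval (flagMap F c t.1)⁻¹
  have hE : LinearMap.ker E = ⊥ := by
    rw [LinearMap.ker_eq_bot']
    intro P hP
    refine Polynomial.eq_zero_of_infinite_isRoot P
      ((Set.finite_singleton (0 : K)).infinite_compl.mono fun y hy => ?_)
    obtain ⟨t, ht⟩ := flagMap_surjective (F := F) c y⁻¹
    have hy0 : y ≠ 0 := hy
    have := congrFun hP ⟨t, by rw [ht]; exact inv_ne_zero hy0⟩
    change P.eval (flagMap F c t)⁻¹ = 0 at this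
    rwa [ht, inv_inv] at this
  have h2 := h1.map' E hE
  have h3 : (fun (n : ℕ+) (t : {t : K // flagMap F c t ≠ 0}) => powerSum F c t.1 n)
      = E ∘ fun n : ℕ+ => expansionPoly F c n :=
    funext fun n => funext fun t => (eval_expansionPoly hc t.2 n.ne_zero).symm
  rw [h3]
  exact h2

theorem linearIndependent_stepSum [IsAlgClosed K] {c : List (K × ℕ)}
    (hc : IsFlag F (flagOf c)) :
    LinearIndependent K fun (x : Letter F)
      (ℓ : {t : K // flagMap F (flagOf c) t ≠ 0} × ℕ) => stepSum (ℓ.1.1, ℓ.2) c x := by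
  convert linearIndependent_mul (linearIndependent_powerSum hc)
    (linearIndependent_units_pow (F := F) (K := K)) using 3
  exact mul_comm _ _

/-- The empty flag detects the coefficient of the empty word. In general, subtracting the evaluation
at `c` from that at `ℓ :: c` leaves a combination of the step sums of the first letters. Their
independence as ℓ varies shows that the tail after each first letter is again killed by every flag,
and induction on the word applies. -/
theorem linearIndependent_evalWord [IsAlgClosed K] :
    LinearIndependent K fun (w : Word F) (c : DecFlag F K) => evalWord c.1 w := by
  classical
  let ev (c : List (K × ℕ)) : (Word F →₀ K) →ₗ[K] K := Finsupp.linearCombination K (evalWord c)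
  have key : ∀ (w : Word F) (l : Word F →₀ K), (∀ c : DecFlag F K, ev c.1 l = 0) → l w = 0 := by
    intro w
    induction w with
    | nil =>
      intro l hl
      have h : ev [] = Finsupp.lapply ([] : Word F) := by
        refine Finsupp.lhom_ext' fun w => LinearMap.ext_ring ?_
        cases w with
        | nil => simp [ev, evalWord]
        | cons x w => simp [ev, evalWord]
      rw [← hl ⟨[], trivial⟩, h, Finsupp.lapply_apply]
    | cons x w ih =>
      intro l hl
      -- the part of `l` supported on the words that begin with `x`
      let tail (x : Letter F) : (Word F →₀ K) →ₗ[K] (Word F →₀ K) :=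
        Finsupp.linearCombination K fun
          | [] => 0
          | y :: w => if y = x then Finsupp.single w 1 else 0
      have htail : tail x l w = l (x :: w) := by
        have : Finsupp.lapply w ∘ₗ tail x = Finsupp.lapply (x :: w) := by
          refine Finsupp.lhom_ext' fun v => LinearMap.ext_ring ?_
          cases v with
          | nil => simp [tail]
          | cons y v =>
            by_cases hy : y = x <;> simp [tail, hy, Finsupp.single_apply]
        exact LinearMap.congr_fun this l
      rw [← htail]
      refine ih _ fun c => ?_
      let A : (Word F →₀ K) →ₗ[K] (Letter F →₀ K) :=
        Finsupp.linearCombination K fun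
          | [] => 0
          | y :: w => Finsupp.single y (evalWord c.1 w)
      have hA : A l x = ev c.1 (tail x l) := by
        have : Finsupp.lapply x ∘ₗ A = ev c.1 ∘ₗ tail x := by
          refine Finsupp.lhom_ext' fun v => LinearMap.ext_ring ?_
          cases v with
          | nil => simp [A, tail]
          | cons y v =>
            by_cases hy : y = x <;> simp [A, tail, ev, hy]
        exact LinearMap.congr_fun this l
      rw [← hA]
      suffices h : A l = 0 by rw [h, Finsupp.zero_apply]
      have hst := linearIndependent_stepSum (F := F) (c := c.1) c.2
      rw [linearIndependent_iff] at hst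
      refine hst (A l) ?_
      funext ℓ
      have h1 : ev ((ℓ.1.1, ℓ.2) :: c.1) = ev c.1 +
          Finsupp.linearCombination K (fun x : Letter F => stepSum (ℓ.1.1, ℓ.2) c.1 x) ∘ₗ A := by
        refine Finsupp.lhom_ext' fun v => LinearMap.ext_ring ?_
        cases v with
        | nil => simp [A, ev, evalWord_nil]
        | cons y v => simp [A, ev, evalWord, mul_comm]
      have hc' : IsFlag F (flagOf ((ℓ.1.1, ℓ.2) :: c.1)) := ⟨ℓ.1.2, c.2⟩
      have h2 := LinearMap.congr_fun h1 l
      rw [LinearMap.add_apply, hl c, hl ⟨_, hc'⟩, zero_add] at h2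
      refine Eq.trans ?_ h2.symm
      rw [LinearMap.comp_apply, Finsupp.linearCombination_apply,
        Finsupp.linearCombination_apply, Finsupp.sum, Finsupp.sum, Finset.sum_apply]
      rfl
  rw [linearIndependent_iff]
  intro l hl
  ext w
  refine key w l fun c => ?_
  have := congrFun hl c
  rw [Finsupp.linearCombination_apply, Finsupp.sum, Finset.sum_apply] at this
  exact this

variable (F) in
/-- The basis of `𝔇` that consists of the words. -/
def wordBasis : Module.Basis (Word F) F (WordAlgebra F) := Finsupp.basisSingleOne

theorem linearIndependent_evalLin [IsAlgClosed K] :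
    LinearIndependent K fun (w : Word F) (c : DecFlag F K) => evalLin c.1 (wordBasis F w) := by
  convert linearIndependent_evalWord (F := F) (K := K) using 3
  rw [← evalLin_word]
  simp [wordBasis, word]

end Separation

/-! ### The bialgebra structure -/

section Laws

section Extensionality

variable {F : Type u} (K : Type u) [Field F] [Fintype F] [Field K] [Algebra F K] [IsAlgClosed K]

theorem evalLin_ext {v w : WordAlgebra F}
    (h : ∀ c : DecFlag F K, evalLin c.1 v = evalLin c.1 w) : v = w :=
  eq_of_forall_eval_eq (wordBasis F) linearIndependent_evalLin h

theorem linearIndependent_evalTensor :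
    LinearIndependent K fun (p : Word F × Word F) (q : DecFlag F K × DecFlag F K) =>
        evalTensor q.1.1 q.2.1 ((wordBasis F).tensorProduct (wordBasis F) p) :=
  linearIndependent_tensor (wordBasis F) (wordBasis F)
    (e := fun c : DecFlag F K => evalLin c.1) (e' := fun c : DecFlag F K => evalLin c.1)
    linearIndependent_evalLin linearIndependent_evalLin

theorem evalTensor_ext {s t : WordAlgebra F ⊗[F] WordAlgebra F}
    (h : ∀ c' c : DecFlag F K, evalTensor c'.1 c.1 s = evalTensor c'.1 c.1 t) : s = t := by
  have h₁ := linearIndependent_evalTensor (F := F) K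
  have h₂ := fun b e => @eq_of_forall_eval_eq F K (WordAlgebra F ⊗[F] WordAlgebra F)
    (Word F × Word F) (DecFlag F K × DecFlag F K) _ _ _ _ _ b e
  exact h₂ _ _ h₁ fun q => h q.1 q.2

variable {K} in
/-- The evaluation of `𝔇 ⊗ (𝔇 ⊗ 𝔇)` at a triple of decorated flags. -/
def evalTriple (c₁ c₂ c₃ : List (K × ℕ)) :
    WordAlgebra F ⊗[F] (WordAlgebra F ⊗[F] WordAlgebra F) →ₗ[F] K :=
  LinearMap.mul' F K ∘ₗ TensorProduct.map (evalLin c₁) (evalTensor c₂ c₃)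

theorem linearIndependent_evalTriple :
    LinearIndependent K fun (p : Word F × Word F × Word F)
      (q : DecFlag F K × DecFlag F K × DecFlag F K) => evalTriple q.1.1 q.2.1.1 q.2.2.1
        ((wordBasis F).tensorProduct ((wordBasis F).tensorProduct (wordBasis F)) p) := by
  have h := fun b b' e e' => @linearIndependent_tensor F K (WordAlgebra F)
    (WordAlgebra F ⊗[F] WordAlgebra F) (Word F) (Word F × Word F) (DecFlag F K)
    (DecFlag F K × DecFlag F K) _ _ _ _ _ _ _ b b' e e'
  exact h _ _ (fun c => evalLin c.1) (fun q => evalTensor q.1.1 q.2.1) linearIndependent_evalLin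
    (linearIndependent_evalTensor K)

theorem evalTriple_ext {s t : WordAlgebra F ⊗[F] (WordAlgebra F ⊗[F] WordAlgebra F)}
    (h : ∀ c₁ c₂ c₃ : DecFlag F K,
      evalTriple c₁.1 c₂.1 c₃.1 s = evalTriple c₁.1 c₂.1 c₃.1 t) : s = t := by
  have h₁ := linearIndependent_evalTriple (F := F) K
  have h₂ := fun b e => @eq_of_forall_eval_eq F K
    (WordAlgebra F ⊗[F] (WordAlgebra F ⊗[F] WordAlgebra F))
    (Word F × Word F × Word F) (DecFlag F K × DecFlag F K × DecFlag F K) _ _ _ _ _ b e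
  exact h₂ _ _ h₁ fun q => h q.1 q.2.1 q.2.2

end Extensionality

section Evaluation

variable {F : Type u} {K : Type u} [Field F] [Fintype F] [Field K] [Algebra F K]

theorem evalTriple_tmul (c₁ c₂ c₃ : List (K × ℕ)) (v : WordAlgebra F)
    (t : WordAlgebra F ⊗[F] WordAlgebra F) :
    evalTriple c₁ c₂ c₃ (v ⊗ₜ[F] t) = evalLin c₁ v * evalTensor c₂ c₃ t := by
  simp [evalTriple]

theorem pushFlag_append (d c l : List (K × ℕ)) :
    pushFlag F (d ++ c) l = pushFlag F (pushFlag F c d) (pushFlag F c l) := by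
  induction l with
  | nil => rfl
  | cons ℓ l ih =>
    have h := flagMap_append F (flagOf d) (flagOf c) ℓ.1
    rw [← flagOf_append, ← flagOf_pushFlag] at h
    exact congrArg₂ List.cons (Prod.ext h rfl) ih

theorem evalTensor_map₂_shuffle {c' c : List (K × ℕ)} (hc' : IsFlag F (flagOf c'))
    (hc : IsFlag F (flagOf c))
    (s t : WordAlgebra F ⊗[F] WordAlgebra F) :
    evalTensor c' c (TensorProduct.map₂ shuffle shuffle s t)
      = evalTensor c' c s * evalTensor c' c t := by
  induction s with
  | zero => simp
  | add s₁ s₂ h₁ h₂ => rw [map_add, LinearMap.add_apply, map_add, h₁, h₂, map_add, add_mul]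
  | tmul a b =>
    induction t with
    | zero => simp
    | add t₁ t₂ h₁ h₂ => rw [map_add, map_add, h₁, h₂, map_add, mul_add]
    | tmul v w =>
      rw [TensorProduct.map₂_apply_tmul, TensorProduct.map_tmul, evalTensor_tmul,
        evalTensor_tmul, evalTensor_tmul, evalLin_shuffle hc', evalLin_shuffle hc]
      ring

theorem algebraMap_counit (v : WordAlgebra F) :
    algebraMap F K (counit v) = evalLin ([] : List (K × ℕ)) v := by
  have : Algebra.linearMap F K ∘ₗ counit = evalLin [] := linExt_ext fun w => by
    rw [LinearMap.comp_apply, evalLin_word, counit, linExt_word]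
    cases w <;> simp [evalWord]
  exact LinearMap.congr_fun this v

end Evaluation

/-! ### The bialgebra laws, tested on evaluations. -/

variable {F : Type u} [Field F] [Finite F]

theorem shuffle_comm (v w : WordAlgebra F) : shuffle v w = shuffle w v := by
  cases nonempty_fintype F
  refine evalLin_ext (AlgebraicClosure F) fun c => ?_
  rw [evalLin_shuffle c.2, evalLin_shuffle c.2, mul_comm]

theorem shuffle_assoc (v w x : WordAlgebra F) :
    shuffle (shuffle v w) x = shuffle v (shuffle w x) := by
  cases nonempty_fintype F
  refine evalLin_ext (AlgebraicClosure F) fun c => ?_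
  simp only [evalLin_shuffle c.2, mul_assoc]

theorem comul_shuffle (v w : WordAlgebra F) :
    comul (shuffle v w) = TensorProduct.map₂ shuffle shuffle (comul v) (comul w) := by
  cases nonempty_fintype F
  refine evalTensor_ext (AlgebraicClosure F) fun c' c => ?_
  rw [evalTensor_map₂_shuffle c'.2 c.2]
  obtain ⟨c'', h, hf⟩ := exists_pushFlag_eq c c'
  rw [← h, evalTensor_comul _ hf, evalTensor_comul _ hf, evalTensor_comul _ hf,
    evalLin_shuffle hf]

/-- Lifting the three flags to d₁, d₂ and c₃, both sides become the evaluation at `d₁ ++ d₂ ++ c₃`,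
bracketed in the two possible ways. -/
theorem comul_coassoc :
    TensorProduct.assoc F (WordAlgebra F) (WordAlgebra F) (WordAlgebra F) ∘ₗ
      comul.rTensor (WordAlgebra F) ∘ₗ comul = comul.lTensor (WordAlgebra F) ∘ₗ comul := by
  cases nonempty_fintype F
  refine LinearMap.ext fun v => evalTriple_ext (AlgebraicClosure F) fun c₁ c₂ c₃ => ?_
  obtain ⟨d₂, h₂, hf₂⟩ := exists_pushFlag_eq c₃ c₂
  obtain ⟨d₁, h₁, hf₁⟩ := exists_pushFlag_eq ⟨d₂ ++ c₃.1, hf₂⟩ c₁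
  replace h₁ : pushFlag F (d₂ ++ c₃.1) d₁ = c₁.1 := h₁
  have h₁' : c₁.1 = pushFlag F c₂.1 (pushFlag F c₃.1 d₁) := by
    rw [← h₁, pushFlag_append, h₂]
  have happ : pushFlag F c₃.1 d₁ ++ c₂.1 = pushFlag F c₃.1 (d₁ ++ d₂) := by
    rw [← h₂, pushFlag, pushFlag, pushFlag, List.map_append]
  have hf₁' : IsFlag F (flagOf ((d₁ ++ d₂) ++ c₃.1)) := by rwa [List.append_assoc]
  have hf₁₂ : IsFlag F (flagOf (pushFlag F c₃.1 d₁ ++ c₂.1)) := by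
    rw [happ, flagOf_pushFlag]
    rw [flagOf_append] at hf₁'
    exact ((isFlag_append F _ _).1 hf₁').1
  have hl : evalTriple c₁.1 c₂.1 c₃.1 ∘ₗ
      (TensorProduct.assoc F (WordAlgebra F) (WordAlgebra F) (WordAlgebra F)).toLinearMap ∘ₗ
        comul.rTensor (WordAlgebra F) = evalTensor (pushFlag F c₃.1 (d₁ ++ d₂)) c₃.1 := by
    refine TensorProduct.ext' fun a b => ?_
    have : ∀ t : WordAlgebra F ⊗[F] WordAlgebra F, evalTriple c₁.1 c₂.1 c₃.1
        (TensorProduct.assoc F (WordAlgebra F) (WordAlgebra F) (WordAlgebra F) (t ⊗ₜ[F] b))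
        = evalTensor c₁.1 c₂.1 t * evalLin c₃.1 b := by
      intro t
      induction t with
      | zero => simp
      | add t₁ t₂ h₁ h₂ => rw [TensorProduct.add_tmul, map_add, map_add, h₁, h₂, map_add, add_mul]
      | tmul v w =>
        rw [TensorProduct.assoc_tmul, evalTriple_tmul, evalTensor_tmul, evalTensor_tmul, mul_assoc]
    rw [LinearMap.comp_apply, LinearMap.comp_apply, LinearMap.rTensor_tmul, evalTensor_tmul,
      ← happ, ← evalTensor_comul _ hf₁₂, ← h₁']
    exact this _
  have hr : evalTriple c₁.1 c₂.1 c₃.1 ∘ₗ comul.lTensor (WordAlgebra F)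
      = evalTensor c₁.1 (d₂ ++ c₃.1) := by
    refine TensorProduct.ext' fun a b => ?_
    rw [LinearMap.comp_apply, LinearMap.lTensor_tmul, evalTriple_tmul, evalTensor_tmul, ← h₂,
      evalTensor_comul _ hf₂]
  have hl' := LinearMap.congr_fun hl (comul v)
  have hr' := LinearMap.congr_fun hr (comul v)
  have h := evalTensor_comul d₁ hf₁ v
  rw [evalTensor_comul _ hf₁', List.append_assoc] at hl'
  rw [h₁] at h
  exact hl'.trans (h.symm.trans hr'.symm)

/-- The counit is evaluation at the empty flag, so this is `[] ++ c = c`. -/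
theorem rTensor_counit_comp_comul :
    counit.rTensor (WordAlgebra F) ∘ₗ comul = TensorProduct.mk F F (WordAlgebra F) 1 := by
  cases nonempty_fintype F
  refine LinearMap.ext fun v => (TensorProduct.lid F (WordAlgebra F)).injective ?_
  refine evalLin_ext (AlgebraicClosure F) fun c => ?_
  have h : evalLin c.1 ∘ₗ (TensorProduct.lid F (WordAlgebra F)).toLinearMap ∘ₗ
      counit.rTensor (WordAlgebra F) = evalTensor [] c.1 := by
    refine TensorProduct.ext' fun a b => ?_
    simp [evalTensor_tmul, ← algebraMap_counit, Algebra.smul_def]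
  have h' := LinearMap.congr_fun h (comul v)
  have h2 := evalTensor_comul [] c.2 v
  simp only [LinearMap.comp_apply, LinearEquiv.coe_coe] at h' ⊢
  rw [h', TensorProduct.mk_apply, TensorProduct.lid_tmul, one_smul]
  exact h2

theorem lTensor_counit_comp_comul :
    counit.lTensor (WordAlgebra F) ∘ₗ comul = (TensorProduct.mk F (WordAlgebra F) F).flip 1 := by
  cases nonempty_fintype F
  refine LinearMap.ext fun v => (TensorProduct.rid F (WordAlgebra F)).injective ?_
  refine evalLin_ext (AlgebraicClosure F) fun c => ?_
  have h : evalLin c.1 ∘ₗ (TensorProduct.rid F (WordAlgebra F)).toLinearMap ∘ₗ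
      counit.lTensor (WordAlgebra F) = evalTensor c.1 [] := by
    refine TensorProduct.ext' fun a b => ?_
    simp [evalTensor_tmul, ← algebraMap_counit, Algebra.smul_def, mul_comm]
  have h' := LinearMap.congr_fun h (comul v)
  have h1 : pushFlag F [] c.1 = c.1 := List.map_id _
  have h2 := evalTensor_comul c.1 (c := []) (by rw [List.append_nil]; exact c.2) v
  rw [h1, List.append_nil] at h2
  simp only [LinearMap.comp_apply, LinearEquiv.coe_coe] at h' ⊢
  rw [h', h2, LinearMap.flip_apply, TensorProduct.mk_apply, TensorProduct.rid_tmul, one_smul]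

theorem counit_shuffle (v w : WordAlgebra F) :
    counit (shuffle v w) = counit v * counit w := by
  cases nonempty_fintype F
  apply (algebraMap F (AlgebraicClosure F)).injective
  rw [map_mul, algebraMap_counit, algebraMap_counit, algebraMap_counit]
  exact evalLin_shuffle (c := []) trivial v w

end Laws

/-! ### The bialgebra on the shuffle algebra. -/

section Bialgebra

/-- The space `𝔇`, with the shuffle product as its multiplication. -/
def ShuffleAlgebra (F : Type u) [Field F] : Type u := WordAlgebra F

variable (F : Type u) [Field F]

instance : AddCommGroup (ShuffleAlgebra F) := inferInstanceAs (AddCommGroup (WordAlgebra F))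

instance : Module F (ShuffleAlgebra F) := inferInstanceAs (Module F (WordAlgebra F))

/-- The identification of `𝔇` with the shuffle algebra. -/
def toShuffle : WordAlgebra F ≃ₗ[F] ShuffleAlgebra F := LinearEquiv.refl F (WordAlgebra F)

variable [Finite F]

instance : CommRing (ShuffleAlgebra F) :=
  { (inferInstance : AddCommGroup (ShuffleAlgebra F)) with
    mul := fun a b => shuffle (F := F) a b
    one := word (F := F) []
    left_distrib := fun a b c => map_add (shuffle (F := F) a) b c
    right_distrib := fun a b c => LinearMap.map_add₂ (shuffle (F := F)) a b c
    zero_mul := fun a => LinearMap.map_zero₂ (shuffle (F := F)) a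
    mul_zero := fun a => map_zero (shuffle (F := F) a)
    mul_assoc := fun a b c => shuffle_assoc (F := F) a b c
    one_mul := fun a => shuffle_word_nil_left (F := F) a
    mul_one := fun a => shuffle_word_nil_right (F := F) a
    mul_comm := fun a b => shuffle_comm (F := F) a b }

instance : Algebra F (ShuffleAlgebra F) :=
  Algebra.ofModule (fun r a b => LinearMap.map_smul₂ (shuffle (F := F)) r a b)
    (fun r a b => map_smul (shuffle (F := F) a) r b)

instance : Coalgebra F (ShuffleAlgebra F) where
  comul := (comul : WordAlgebra F →ₗ[F] WordAlgebra F ⊗[F] WordAlgebra F)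
  counit := (counit : WordAlgebra F →ₗ[F] F)
  coassoc := comul_coassoc (F := F)
  rTensor_counit_comp_comul := rTensor_counit_comp_comul (F := F)
  lTensor_counit_comp_comul := lTensor_counit_comp_comul (F := F)

theorem map₂_shuffle_eq_mul (s t : ShuffleAlgebra F ⊗[F] ShuffleAlgebra F) :
    TensorProduct.map₂ (shuffle (F := F)) (shuffle (F := F)) s t = s * t := by
  induction s with
  | zero => rw [zero_mul]; exact LinearMap.map_zero₂ _ _
  | add s₁ s₂ h₁ h₂ => rw [add_mul, ← h₁, ← h₂]; exact LinearMap.map_add₂ _ _ _ _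
  | tmul a b =>
    induction t with
    | zero => rw [mul_zero]; exact map_zero _
    | add t₁ t₂ h₁ h₂ => rw [mul_add, ← h₁, ← h₂]; exact map_add _ _ _
    | tmul v w => rw [Algebra.TensorProduct.tmul_mul_tmul]; rfl

instance : Bialgebra F (ShuffleAlgebra F) :=
  Bialgebra.mk' F (ShuffleAlgebra F)
    (by
      change (counit (F := F)) (word []) = 1
      simp [counit])
    (fun {a b} => counit_shuffle (F := F) a b)
    (by
      change (comul (F := F)) (word []) = _
      simp only [comul, linExt_word, wordComul]
      rfl)
    (fun {a b} => (comul_shuffle (F := F) a b).trans (map₂_shuffle_eq_mul F _ _))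

end Bialgebra

/-! ### Connected graded bialgebras -/

section GradedBialgebra

variable {k A : Type u} [Field k]

/-- `⨁_{i + j = n} A_i ⊗ A_j` inside `A ⊗ A`. -/
def tensorPart [AddCommGroup A] [Module k A] (𝒜 : ℕ → Submodule k A) (n : ℕ) :
    Submodule k (A ⊗[k] A) :=
  ⨆ (i : ℕ) (j : ℕ) (_ : i + j = n), Submodule.map₂ (TensorProduct.mk k A A) (𝒜 i) (𝒜 j)

theorem tmul_mem_tensorPart [AddCommGroup A] [Module k A] {𝒜 : ℕ → Submodule k A} {n i j : ℕ}
    (h : i + j = n) {a b : A} (ha : a ∈ 𝒜 i) (hb : b ∈ 𝒜 j) : a ⊗ₜ[k] b ∈ tensorPart 𝒜 n :=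
  Submodule.mem_iSup_of_mem i <| Submodule.mem_iSup_of_mem j <| Submodule.mem_iSup_of_mem h <|
    Submodule.apply_mem_map₂ (TensorProduct.mk k A A) ha hb

theorem tensorPart_le [AddCommGroup A] [Module k A] {𝒜 : ℕ → Submodule k A} {n : ℕ}
    {P : Submodule k (A ⊗[k] A)}
    (h : ∀ i j, i + j = n → ∀ a ∈ 𝒜 i, ∀ b ∈ 𝒜 j, a ⊗ₜ[k] b ∈ P) : tensorPart 𝒜 n ≤ P :=
  iSup_le fun i => iSup_le fun j => iSup_le fun hij => Submodule.map₂_le.2 fun a ha b hb =>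
    h i j hij a ha b hb

theorem eq_of_mem_tensorPart [AddCommGroup A] [Module k A] {M : Type*} [AddCommGroup M]
    [Module k M] {𝒜 : ℕ → Submodule k A} {n : ℕ} {f g : A ⊗[k] A →ₗ[k] M}
    (h : ∀ i j, i + j = n → ∀ a ∈ 𝒜 i, ∀ b ∈ 𝒜 j, f (a ⊗ₜ[k] b) = g (a ⊗ₜ[k] b))
    {t : A ⊗[k] A} (ht : t ∈ tensorPart 𝒜 n) : f t = g t :=
  tensorPart_le (P := LinearMap.eqLocus f g) (fun i j hij a ha b hb => h i j hij a ha b hb) ht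

variable [Ring A] [Bialgebra k A]

/-- `𝒜` is a connected grading of the bialgebra `A`, up to being a direct sum decomposition. -/
structure IsConnectedGrading (𝒜 : ℕ → Submodule k A) : Prop where
  mul_mem : ∀ r s : ℕ, ∀ x ∈ 𝒜 r, ∀ y ∈ 𝒜 s, x * y ∈ 𝒜 (r + s)
  comul_mem : ∀ n : ℕ, ∀ x ∈ 𝒜 n, Coalgebra.comul (R := k) x ∈ tensorPart 𝒜 n
  zero_eq : 𝒜 0 = LinearMap.range (Algebra.linearMap k A)
  counit_eq_zero : ∀ n : ℕ, n ≠ 0 → ∀ x ∈ 𝒜 n, Coalgebra.counit (R := k) x = 0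

variable (k A) in
/-- The difference of the identity and the unit in the convolution algebra. -/
def augmentation : WithConv (A →ₗ[k] A) := WithConv.toConv LinearMap.id - 1

theorem augmentation_apply (x : A) :
    augmentation k A x = x - algebraMap k A (Coalgebra.counit (R := k) x) := rfl

namespace IsConnectedGrading

variable {𝒜 : ℕ → Submodule k A}

theorem augmentation_zero (h : IsConnectedGrading 𝒜) {x : A} (hx : x ∈ 𝒜 0) :
    augmentation k A x = 0 := by
  rw [h.zero_eq] at hx
  obtain ⟨c, rfl⟩ := hx
  simp [augmentation_apply]

theorem augmentation_pos (h : IsConnectedGrading 𝒜) {n : ℕ} (hn : n ≠ 0) {x : A} (hx : x ∈ 𝒜 n) :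
    augmentation k A x = x := by
  rw [augmentation_apply, h.counit_eq_zero n hn x hx, map_zero, sub_zero]

/-- In each component of the coproduct, either the right factor has degree 0 and is killed, or the
left factor has smaller degree and induction applies. -/
theorem augmentation_pow_eq_zero (h : IsConnectedGrading 𝒜) {n m : ℕ} (hm : m < n)
    {x : A} (hx : x ∈ 𝒜 m) :
    (augmentation k A ^ n) x = 0 := by
  induction n generalizing m x with
  | zero => omega
  | succ n ih =>
    rw [pow_succ, LinearMap.convMul_apply]
    refine eq_of_mem_tensorPart (f := LinearMap.mul' k A ∘ₗ TensorProduct.map _ _) (g := 0)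
      ?_ (h.comul_mem m x hx)
    intro i j hij a ha b hb
    rw [LinearMap.comp_apply, TensorProduct.map_tmul, LinearMap.mul'_apply, LinearMap.zero_apply]
    rcases Nat.eq_zero_or_pos j with rfl | hj
    · exact mul_eq_zero_of_right _ (h.augmentation_zero hb)
    · exact mul_eq_zero_of_left (ih (by omega) ha) _

theorem augmentation_pow_mem (h : IsConnectedGrading 𝒜) (n : ℕ) {m : ℕ} {x : A} (hx : x ∈ 𝒜 m) :
    (augmentation k A ^ n) x ∈ 𝒜 m := by
  have hJ : ∀ {m : ℕ} {x : A}, x ∈ 𝒜 m → augmentation k A x ∈ 𝒜 m := by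
    intro m x hx
    rcases Nat.eq_zero_or_pos m with rfl | hm
    · rw [h.augmentation_zero hx]
      exact zero_mem _
    · rwa [h.augmentation_pos hm.ne' hx]
  induction n generalizing m x with
  | zero =>
    rw [pow_zero, LinearMap.convOne_apply]
    rcases Nat.eq_zero_or_pos m with rfl | hm
    · rw [h.zero_eq]
      exact ⟨_, rfl⟩
    · rw [h.counit_eq_zero m hm.ne' x hx, map_zero]
      exact zero_mem _
  | succ n ih =>
    rw [pow_succ, LinearMap.convMul_apply]
    refine tensorPart_le (P := (𝒜 m).comap (LinearMap.mul' k A ∘ₗ TensorProduct.map _ _)) ?_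
      (h.comul_mem m x hx)
    intro i j hij a ha b hb
    rw [Submodule.mem_comap, LinearMap.comp_apply, TensorProduct.map_tmul, LinearMap.mul'_apply,
      ← hij]
    exact h.mul_mem i j _ (ih ha) _ (hJ hb)

end IsConnectedGrading

variable (k A) in
/-- The partial sums of the geometric series for the convolution inverse of the identity. -/
def partialAntipode (n : ℕ) : WithConv (A →ₗ[k] A) :=
  ∑ i ∈ Finset.range (n + 1), (-augmentation k A) ^ i

theorem toConv_id_eq : WithConv.toConv LinearMap.id = 1 - -augmentation k A := by
  rw [augmentation]
  abel

theorem conv_sum_apply (s : Finset ℕ) (f : ℕ → WithConv (A →ₗ[k] A)) (x : A) :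
    (∑ i ∈ s, f i) x = ∑ i ∈ s, f i x := by
  classical
  induction s using Finset.induction_on with
  | empty => rfl
  | insert a s ha ih =>
    rw [Finset.sum_insert ha, Finset.sum_insert ha, ← ih]
    rfl

theorem neg_pow_augmentation_apply (n : ℕ) (x : A) :
    ((-augmentation k A) ^ n) x = (-1 : k) ^ n • (augmentation k A ^ n) x := by
  rcases Nat.even_or_odd n with hn | hn
  · rw [hn.neg_pow, hn.neg_one_pow, one_smul]
  · rw [hn.neg_pow, hn.neg_one_pow, neg_one_smul]
    rfl

namespace IsConnectedGrading

variable {𝒜 : ℕ → Submodule k A}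

theorem partialAntipode_eq (h : IsConnectedGrading 𝒜) {n m : ℕ} (hmn : m ≤ n)
    {x : A} (hx : x ∈ 𝒜 m) :
    partialAntipode k A n x = partialAntipode k A m x := by
  rw [partialAntipode, partialAntipode, conv_sum_apply, conv_sum_apply]
  symm
  refine Finset.sum_subset (Finset.range_mono (by omega)) fun i _ hi => ?_
  rw [neg_pow_augmentation_apply, h.augmentation_pow_eq_zero (by simpa using hi) hx, smul_zero]

theorem partialAntipode_mem (h : IsConnectedGrading 𝒜) (n : ℕ) {m : ℕ} {x : A} (hx : x ∈ 𝒜 m) :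
    partialAntipode k A n x ∈ 𝒜 m := by
  rw [partialAntipode, conv_sum_apply]
  refine Submodule.sum_mem _ fun i _ => ?_
  rw [neg_pow_augmentation_apply]
  exact Submodule.smul_mem _ _ (h.augmentation_pow_mem i hx)

/-- On degree n the map `S` may be replaced by a fixed partial sum of the geometric series. The
product telescopes to 1 - (-J)^(n+1), whose last term vanishes there. -/
theorem mul_rTensor_comul (h : IsConnectedGrading 𝒜) {S : A →ₗ[k] A}
    (hS : ∀ n, ∀ x ∈ 𝒜 n, S x = partialAntipode k A n x) {n : ℕ} {x : A} (hx : x ∈ 𝒜 n) :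
    LinearMap.mul' k A (S.rTensor A (Coalgebra.comul x))
      = algebraMap k A (Coalgebra.counit (R := k) x) := by
  have h1 : LinearMap.mul' k A (S.rTensor A (Coalgebra.comul x))
      = (partialAntipode k A n * WithConv.toConv LinearMap.id : WithConv (A →ₗ[k] A)) x := by
    rw [LinearMap.convMul_apply]
    refine eq_of_mem_tensorPart (f := LinearMap.mul' k A ∘ₗ S.rTensor A)
      (g := LinearMap.mul' k A ∘ₗ TensorProduct.map _ _) ?_ (h.comul_mem n x hx)
    intro i j hij a ha b hb
    rw [LinearMap.comp_apply, LinearMap.comp_apply, LinearMap.rTensor_tmul,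
      TensorProduct.map_tmul, hS i a ha, ← h.partialAntipode_eq (show i ≤ n by omega) ha]
    rfl
  have h2 : partialAntipode k A n * WithConv.toConv LinearMap.id
      = 1 - (-augmentation k A) ^ (n + 1) := by
    rw [toConv_id_eq, partialAntipode, geom_sum_mul_neg]
  have h3 : (1 - (-augmentation k A) ^ (n + 1)) x
      = (1 : WithConv (A →ₗ[k] A)) x - ((-augmentation k A) ^ (n + 1)) x := rfl
  rw [h1, h2, h3, neg_pow_augmentation_apply, h.augmentation_pow_eq_zero (Nat.lt_succ_self n) hx,
    smul_zero, sub_zero, LinearMap.convOne_apply]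

theorem mul_lTensor_comul (h : IsConnectedGrading 𝒜) {S : A →ₗ[k] A}
    (hS : ∀ n, ∀ x ∈ 𝒜 n, S x = partialAntipode k A n x) {n : ℕ} {x : A} (hx : x ∈ 𝒜 n) :
    LinearMap.mul' k A (S.lTensor A (Coalgebra.comul x))
      = algebraMap k A (Coalgebra.counit (R := k) x) := by
  have h1 : LinearMap.mul' k A (S.lTensor A (Coalgebra.comul x))
      = (WithConv.toConv LinearMap.id * partialAntipode k A n : WithConv (A →ₗ[k] A)) x := by
    rw [LinearMap.convMul_apply]
    refine eq_of_mem_tensorPart (f := LinearMap.mul' k A ∘ₗ S.lTensor A)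
      (g := LinearMap.mul' k A ∘ₗ TensorProduct.map _ _) ?_ (h.comul_mem n x hx)
    intro i j hij a ha b hb
    rw [LinearMap.comp_apply, LinearMap.comp_apply, LinearMap.lTensor_tmul,
      TensorProduct.map_tmul, hS j b hb, ← h.partialAntipode_eq (show j ≤ n by omega) hb]
    rfl
  have h2 : WithConv.toConv LinearMap.id * partialAntipode k A n
      = 1 - (-augmentation k A) ^ (n + 1) := by
    rw [toConv_id_eq, partialAntipode, mul_neg_geom_sum]
  have h3 : (1 - (-augmentation k A) ^ (n + 1)) x
      = (1 : WithConv (A →ₗ[k] A)) x - ((-augmentation k A) ^ (n + 1)) x := rfl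
  rw [h1, h2, h3, neg_pow_augmentation_apply, h.augmentation_pow_eq_zero (Nat.lt_succ_self n) hx,
    smul_zero, sub_zero, LinearMap.convOne_apply]

/-- Expand (id - u) ⊗ (id - u) on Δ(x): the counit laws evaluate the two mixed terms, and u ⊗ u
contributes 0 because the counit kills x. -/
theorem comul_eq (h : IsConnectedGrading 𝒜) {n : ℕ} (hn : n ≠ 0) {x : A} (hx : x ∈ 𝒜 n) :
    Coalgebra.comul (R := k) x = 1 ⊗ₜ[k] x + x ⊗ₜ[k] 1 +
      TensorProduct.map (augmentation k A).ofConv (augmentation k A).ofConv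
        (Coalgebra.comul x) := by
  set u : A →ₗ[k] A := Algebra.linearMap k A ∘ₗ Coalgebra.counit with hu
  have hJ : (augmentation k A).ofConv = LinearMap.id - u := rfl
  have h1 : TensorProduct.map LinearMap.id u (Coalgebra.comul x) = x ⊗ₜ[k] 1 := by
    have e : TensorProduct.map LinearMap.id u
        = (Algebra.linearMap k A).lTensor A ∘ₗ (Coalgebra.counit (R := k)).lTensor A := by
      rw [← LinearMap.lTensor_comp]; rfl
    rw [e, LinearMap.comp_apply, Coalgebra.lTensor_counit_comul, LinearMap.lTensor_tmul]
    simp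
  have h2 : TensorProduct.map u LinearMap.id (Coalgebra.comul x) = 1 ⊗ₜ[k] x := by
    have e : TensorProduct.map u LinearMap.id
        = (Algebra.linearMap k A).rTensor A ∘ₗ (Coalgebra.counit (R := k)).rTensor A := by
      rw [← LinearMap.rTensor_comp]; rfl
    rw [e, LinearMap.comp_apply, Coalgebra.rTensor_counit_comul, LinearMap.rTensor_tmul]
    simp
  have h3 : TensorProduct.map u u (Coalgebra.comul x) = 0 := by
    have e : TensorProduct.map u u
        = TensorProduct.map u LinearMap.id ∘ₗ TensorProduct.map LinearMap.id u := by
      rw [← TensorProduct.map_comp]; rfl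
    rw [e, LinearMap.comp_apply, h1, TensorProduct.map_tmul, hu, LinearMap.comp_apply,
      h.counit_eq_zero n hn x hx, map_zero, TensorProduct.zero_tmul]
  have e : TensorProduct.map (LinearMap.id - u) (LinearMap.id - u)
      = TensorProduct.map LinearMap.id LinearMap.id - TensorProduct.map LinearMap.id u
        - TensorProduct.map u LinearMap.id + TensorProduct.map u u := by
    refine TensorProduct.ext' fun a b => ?_
    simp [TensorProduct.sub_tmul, TensorProduct.tmul_sub]
    abel
  rw [hJ, e]
  simp only [LinearMap.add_apply, LinearMap.sub_apply, h1, h2, h3, TensorProduct.map_id,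
    LinearMap.id_apply]
  abel

end IsConnectedGrading

end GradedBialgebra

/-! ### The recursion for the antipode. -/

section GradedHopf

variable {k A : Type u} [Field k] [Ring A] [HopfAlgebra k A]

theorem IsConnectedGrading.antipodeIsRecursive {𝒜 : ℕ → Submodule k A}
    (h : IsConnectedGrading 𝒜) : AntipodeIsRecursive 𝒜 := by
  have hone : HopfAlgebra.antipode k (1 : A) = 1 := HopfAlgebra.antipode_one
  constructor
  · intro x hx
    rw [h.zero_eq] at hx
    obtain ⟨c, rfl⟩ := hx
    rw [Algebra.linearMap_apply, Algebra.algebraMap_eq_smul_one, map_smul, hone]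
  · intro n hn x hx
    have hn' : n ≠ 0 := by omega
    have hΔ := h.comul_eq hn' hx
    refine ⟨_, ?_, hΔ, ?_⟩
    · refine tensorPart_le (P := (reducedTensorDegree 𝒜 n).comap (TensorProduct.map
        (augmentation k A).ofConv (augmentation k A).ofConv)) ?_ (h.comul_mem n x hx)
      intro i j hij a ha b hb
      rw [Submodule.mem_comap, TensorProduct.map_tmul]
      rcases Nat.eq_zero_or_pos i with rfl | hi
      · have : (augmentation k A).ofConv a = 0 := h.augmentation_zero ha
        rw [this, TensorProduct.zero_tmul]
        exact zero_mem _
      rcases Nat.eq_zero_or_pos j with rfl | hj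
      · have : (augmentation k A).ofConv b = 0 := h.augmentation_zero hb
        rw [this, TensorProduct.tmul_zero]
        exact zero_mem _
      have ha' : (augmentation k A).ofConv a = a := h.augmentation_pos hi.ne' ha
      have hb' : (augmentation k A).ofConv b = b := h.augmentation_pos hj.ne' hb
      rw [ha', hb']
      exact Submodule.mem_iSup_of_mem i <| Submodule.mem_iSup_of_mem j <|
        Submodule.mem_iSup_of_mem ⟨hij, hi, hj⟩ <|
          Submodule.apply_mem_map₂ (TensorProduct.mk k A A) ha hb
    -- The recursion is the left antipode axiom, whose right side vanishes in positive degree.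
    · have h1 := HopfAlgebra.mul_antipode_rTensor_comul_apply (R := k) x
      rw [hΔ, h.counit_eq_zero n hn' x hx, map_zero, map_add, map_add, map_add, map_add,
        LinearMap.rTensor_tmul, LinearMap.rTensor_tmul, LinearMap.mul'_apply,
        LinearMap.mul'_apply, hone, one_mul, mul_one] at h1
      rw [← sub_eq_zero, ← h1]
      abel

end GradedHopf

/-! ### The grading by the weight -/

section Weight

variable {F : Type u} [Field F]

theorem weight_cons (x : Letter F) (w : Word F) : weight (x :: w) = x.1 + weight w := by
  simp [weight]

theorem word_mem_weightPart {w : Word F} {n : ℕ} (h : weight w = n) : word w ∈ weightPart F n :=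
  Submodule.subset_span ⟨w, h, rfl⟩

theorem weightPart_le {n : ℕ} {P : Submodule F (WordAlgebra F)}
    (h : ∀ w : Word F, weight w = n → word w ∈ P) : weightPart F n ≤ P := by
  refine Submodule.span_le.2 ?_
  rintro _ ⟨w, hw, rfl⟩
  exact h w hw

theorem cons_mem_weightPart (x : Letter F) {n m : ℕ} (h : (x.1 : ℕ) + n = m)
    {v : WordAlgebra F} (hv : v ∈ weightPart F n) : cons x v ∈ weightPart F m := by
  refine weightPart_le (P := (weightPart F m).comap (cons x)) (fun w hw => ?_) hv
  rw [Submodule.mem_comap, cons_word]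
  exact word_mem_weightPart (by rw [weight_cons, hw, h])

theorem pairsWithSum_coe {n : ℕ+} {p : ℕ+ × ℕ+} (h : p ∈ pairsWithSum n) :
    (p.1 : ℕ) + p.2 = n := by
  rw [← mem_pairsWithSum.1 h]
  rfl

theorem letterShuffle_mem (x : Letter F) (b : Word F) :
    letterShuffle x b ∈ weightPart F (x.1 + weight b) := by
  induction b generalizing x with
  | nil => exact word_mem_weightPart (weight_cons _ _)
  | cons y b ih =>
    rw [letterShuffle, weight_cons]
    refine add_mem (add_mem ?_ ?_) (add_mem ?_ (Submodule.sum_mem _ fun p hp => ?_))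
    · exact cons_mem_weightPart _ rfl (word_mem_weightPart (weight_cons _ _))
    · exact cons_mem_weightPart _ (by omega) (ih x)
    · exact cons_mem_weightPart _ (by rw [PNat.add_coe]; omega) (word_mem_weightPart rfl)
    · refine Submodule.smul_mem _ _ (cons_mem_weightPart _ ?_ (ih _))
      have := pairsWithSum_coe hp
      rw [PNat.add_coe] at this
      dsimp only
      omega

theorem wordShuffle_mem (a b : Word F) :
    wordShuffle a b ∈ weightPart F (weight a + weight b) := by
  induction a, b using wordShuffle.induct with
  | case1 b =>
    rw [wordShuffle]
    refine word_mem_weightPart ?_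
    simp [weight]
  | case2 x a =>
    rw [wordShuffle]
    refine word_mem_weightPart ?_
    simp [weight]
  | case3 x a y b h1 h2 h3 =>
    rw [weight_cons, weight_cons] at *
    rw [wordShuffle]
    refine add_mem (add_mem ?_ ?_) (add_mem ?_ (Submodule.sum_mem _ fun p hp => ?_))
    · exact cons_mem_weightPart _ (by omega) h1
    · exact cons_mem_weightPart _ (by omega) h2
    · exact cons_mem_weightPart _ (by rw [PNat.add_coe]; omega) h3
    · have := pairsWithSum_coe hp
      rw [PNat.add_coe] at this
      refine Submodule.smul_mem _ _ (cons_mem_weightPart _ (n := p.2 + (weight a + weight b)) ?_ ?_)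
      · dsimp only
        omega
      · refine weightPart_le (P := (weightPart F (p.2 + (weight a + weight b))).comap
          (linExt (letterShuffle ((p.2, 1) : Letter F)))) (fun w hw => ?_) h3
        have hl := letterShuffle_mem ((p.2, 1) : Letter F) w
        rw [hw] at hl
        rwa [Submodule.mem_comap, linExt_word]

theorem shuffle_mem {r s : ℕ} {v w : WordAlgebra F} (hv : v ∈ weightPart F r)
    (hw : w ∈ weightPart F s) : shuffle v w ∈ weightPart F (r + s) := by
  refine weightPart_le (P := (weightPart F (r + s)).comap (shuffle.flip w)) (fun a ha => ?_) hv
  refine weightPart_le (P := (weightPart F (r + s)).comap (shuffle (word a))) (fun b hb => ?_) hw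
  rw [Submodule.mem_comap, shuffle_word_word, ← ha, ← hb]
  exact wordShuffle_mem a b

theorem concat_mem {r s : ℕ} {v w : WordAlgebra F} (hv : v ∈ weightPart F r)
    (hw : w ∈ weightPart F s) : concat v w ∈ weightPart F (r + s) := by
  refine weightPart_le (P := (weightPart F (r + s)).comap (concat.flip w)) (fun a ha => ?_) hv
  refine weightPart_le (P := (weightPart F (r + s)).comap (concat (word a))) (fun b hb => ?_) hw
  rw [Submodule.mem_comap, concat, bilinExt_word_word]
  exact word_mem_weightPart (by rw [← ha, ← hb]; simp [weight])

theorem bracket_mem (l : List ℕ+) : bracket F l ∈ weightPart F (sigmaWeight l) := by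
  refine Submodule.smul_mem _ _ ?_
  induction l with
  | nil => exact word_mem_weightPart rfl
  | cons i l ih =>
    rw [List.map_cons, List.foldr_cons, sigmaWeight_cons]
    exact shuffle_mem (word_mem_weightPart (by simp [weight])) ih

theorem letterTail_mem (x : Letter F) : letterTail x ∈ tensorPart (weightPart F) x.1 :=
  Submodule.sum_mem _ fun p hp => Submodule.smul_mem _ _ <|
    tmul_mem_tensorPart (mem_splittings.1 hp) (word_mem_weightPart (by simp [weight]))
      (bracket_mem p.2)

theorem map₂_concat_shuffle_mem {r s : ℕ} {t t' : WordAlgebra F ⊗[F] WordAlgebra F}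
    (ht : t ∈ tensorPart (weightPart F) r) (ht' : t' ∈ tensorPart (weightPart F) s) :
    TensorProduct.map₂ concat shuffle t t' ∈ tensorPart (weightPart F) (r + s) := by
  refine tensorPart_le (P := (tensorPart (weightPart F) (r + s)).comap
    ((TensorProduct.map₂ concat shuffle).flip t')) (fun i j hij a ha b hb => ?_) ht
  refine tensorPart_le (P := (tensorPart (weightPart F) (r + s)).comap
    (TensorProduct.map₂ concat shuffle (a ⊗ₜ[F] b))) (fun i' j' hij' v hv w hw => ?_) ht'
  rw [Submodule.mem_comap, TensorProduct.map₂_apply_tmul, TensorProduct.map_tmul]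
  exact tmul_mem_tensorPart (by omega) (concat_mem ha hv) (shuffle_mem hb hw)

theorem comul_mem {n : ℕ} {v : WordAlgebra F} (hv : v ∈ weightPart F n) :
    comul v ∈ tensorPart (weightPart F) n := by
  refine weightPart_le (P := (tensorPart (weightPart F) n).comap comul) (fun w hw => ?_) hv
  rw [Submodule.mem_comap, ← hw]
  clear hw
  induction w with
  | nil =>
    simp only [comul, linExt_word, wordComul]
    exact tmul_mem_tensorPart (zero_add 0) (word_mem_weightPart rfl) (word_mem_weightPart rfl)
  | cons x w ih =>
    rw [comul_cons]
    refine add_mem (tmul_mem_tensorPart (zero_add _) (word_mem_weightPart rfl)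
      (word_mem_weightPart rfl)) ?_
    rw [weight_cons]
    exact map₂_concat_shuffle_mem (letterTail_mem x) ih

theorem weight_eq_zero {w : Word F} : weight w = 0 ↔ w = [] := by
  cases w with
  | nil => simp [weight]
  | cons x w =>
    have := x.1.pos
    rw [weight_cons]
    simp

theorem weightPart_zero : weightPart F 0 = LinearMap.range (unit (F := F)) := by
  apply le_antisymm
  · refine weightPart_le fun w hw => ⟨1, ?_⟩
    rw [weight_eq_zero.1 hw]
    simp [unit]
  · rintro _ ⟨c, rfl⟩
    exact Submodule.smul_mem _ c (word_mem_weightPart rfl)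

theorem counit_eq_zero {n : ℕ} (hn : n ≠ 0) {v : WordAlgebra F} (hv : v ∈ weightPart F n) :
    counit v = 0 := by
  refine weightPart_le (P := LinearMap.ker counit) (fun w hw => ?_) hv
  rw [LinearMap.mem_ker, counit, linExt_word, if_neg]
  rintro rfl
  exact hn hw.symm

theorem finite_weight_eq [Finite F] (n : ℕ) : {w : Word F | weight w = n}.Finite := by
  induction n using Nat.strong_induction_on with
  | _ n ih =>
    refine ((Set.finite_singleton ([] : Word F)).union
      ((Set.finite_Iio n).biUnion fun m hm => Set.Finite.image2 (fun (ε : Fˣ) w =>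
        ((Nat.toPNat' (n - m), ε) : Letter F) :: w) Set.finite_univ (ih m hm))).subset ?_
    rintro (_ | ⟨x, w⟩) h
    · simp
    · right
      have h' : (x.1 : ℕ) + weight w = n := by rw [← weight_cons]; exact h
      have hx := x.1.pos
      refine Set.mem_biUnion (x := weight w) (by simp only [Set.mem_Iio]; omega)
        ⟨x.2, Set.mem_univ _, w, rfl, ?_⟩
      have : n - weight w = (x.1 : ℕ) := by omega
      dsimp only
      rw [this, PNat.coe_toPNat']

theorem weightPart_eq_supported (n : ℕ) :
    weightPart F n = Finsupp.supported F F {w : Word F | weight w = n} :=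
  (Finsupp.supported_eq_span_single F _).symm

theorem iSup_weightPart : ⨆ n, weightPart F n = ⊤ := by
  rw [eq_top_iff, ← (wordBasis F).span_eq]
  refine Submodule.span_le.2 ?_
  rintro _ ⟨w, rfl⟩
  refine Submodule.mem_iSup_of_mem (weight w) ?_
  simpa [wordBasis, word] using word_mem_weightPart (w := w) rfl

theorem weightPart_isInternal : DirectSum.IsInternal (weightPart F) := by
  refine DirectSum.isInternal_submodule_of_iSupIndep_of_iSup_eq_top ?_ iSup_weightPart
  intro n
  simp only [weightPart_eq_supported]
  refine Disjoint.mono_right (iSup₂_le fun j hj => Finsupp.supported_mono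
    (t := {w : Word F | weight w ≠ n}) fun w hw => ?_)
    (Finsupp.disjoint_supported_supported (Set.disjoint_left.2 fun w hw hw' => hw' hw))
  rw [Set.mem_ofPred_eq] at hw ⊢
  rwa [hw]

end Weight

/-! ### The Hopf algebra on the shuffle algebra. -/

section Hopf

variable (F : Type u) [Field F] [Finite F]

/-- The homogeneous parts of the shuffle algebra for the grading by the weight. -/
def shufflePart (n : ℕ) : Submodule F (ShuffleAlgebra F) :=
  (weightPart F n).map (toShuffle F).toLinearMap

theorem shufflePart_eq (n : ℕ) : shufflePart F n = weightPart F n := Submodule.map_id _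

theorem tensorPart_shufflePart : tensorPart (shufflePart F) = tensorPart (weightPart F) :=
  congrArg (tensorPart (k := F) (A := ShuffleAlgebra F)) (funext (shufflePart_eq F))

theorem isConnectedGrading_shufflePart : IsConnectedGrading (shufflePart F) where
  mul_mem r s x hx y hy := by
    rw [shufflePart_eq] at *
    exact shuffle_mem hx hy
  comul_mem n x hx := by
    rw [tensorPart_shufflePart]
    rw [shufflePart_eq] at hx
    exact comul_mem hx
  zero_eq := by
    rw [shufflePart_eq, weightPart_zero]
    rfl
  counit_eq_zero n hn x hx := by
    rw [shufflePart_eq] at hx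
    exact counit_eq_zero hn hx

/-- The antipode of the shuffle algebra. -/
def shuffleAntipode : ShuffleAlgebra F →ₗ[F] ShuffleAlgebra F :=
  linExt (F := F) (M := ShuffleAlgebra F) fun w =>
    partialAntipode F (ShuffleAlgebra F) (weight w) (toShuffle F (word w))

theorem shuffleAntipode_eq (n : ℕ) (x : ShuffleAlgebra F) (hx : x ∈ shufflePart F n) :
    shuffleAntipode F x = partialAntipode F (ShuffleAlgebra F) n x := by
  rw [shufflePart_eq] at hx
  refine weightPart_le (P := LinearMap.eqLocus
    (shuffleAntipode F ∘ₗ (toShuffle F).toLinearMap)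
    ((partialAntipode F (ShuffleAlgebra F) n).ofConv ∘ₗ (toShuffle F).toLinearMap))
    (fun w hw => ?_) hx
  rw [LinearMap.mem_eqLocus]
  refine (linExt_word _ w).trans ?_
  rw [hw]
  rfl

theorem shuffleAlgebra_hom_ext {M : Type*} [AddCommGroup M] [Module F M]
    {f g : ShuffleAlgebra F →ₗ[F] M}
    (h : ∀ n, ∀ x ∈ shufflePart F n, f x = g x) : f = g := by
  refine LinearMap.ext fun x => ?_
  have hx : ∀ y : WordAlgebra F, y ∈ ⨆ n, weightPart F n := fun y => by
    rw [iSup_weightPart]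
    exact Submodule.mem_top
  have hle : (⨆ n, shufflePart F n : Submodule F (ShuffleAlgebra F)) ≤ LinearMap.eqLocus f g :=
    iSup_le fun n x hx => h n x hx
  rw [funext (shufflePart_eq F)] at hle
  exact hle (hx x)

instance : HopfAlgebra F (ShuffleAlgebra F) where
  antipode := shuffleAntipode F
  mul_antipode_rTensor_comul := shuffleAlgebra_hom_ext F fun _ _ hx =>
    (isConnectedGrading_shufflePart F).mul_rTensor_comul (shuffleAntipode_eq F) hx
  mul_antipode_lTensor_comul := shuffleAlgebra_hom_ext F fun _ _ hx =>
    (isConnectedGrading_shufflePart F).mul_lTensor_comul (shuffleAntipode_eq F) hx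

theorem isGradedHopf_shufflePart : IsGradedHopf (shufflePart F) where
  isInternal := by
    rw [funext (shufflePart_eq F)]
    exact weightPart_isInternal
  mul_mem := (isConnectedGrading_shufflePart F).mul_mem
  comul_mem := (isConnectedGrading_shufflePart F).comul_mem
  antipode_mem n x hx := by
    have : HopfAlgebra.antipode F x = shuffleAntipode F x := rfl
    rw [this, shuffleAntipode_eq F n x hx]
    exact (isConnectedGrading_shufflePart F).partialAntipode_mem n hx

theorem isFiniteType_shufflePart : IsFiniteType (shufflePart F) := by
  intro n
  rw [shufflePart_eq]
  exact FiniteDimensional.span_of_finite F ((finite_weight_eq n).image word)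

end Hopf

end AMZV

end

theorem theorem6 (F : Type u) [Field F] [Finite F] :
    ∃ (A : Type u) (_ : CommRing A) (_ : HopfAlgebra F A) (e : AMZV.WordAlgebra F ≃ₗ[F] A),
      -- `e` identifies the structure of `A` with the quintuple `(⧢, u, Δ, ε)` on `𝔇`
      (∀ a b : AMZV.WordAlgebra F, e (AMZV.shuffle a b) = e a * e b) ∧
      (∀ c : F, e (AMZV.unit c) = algebraMap F A c) ∧
      (∀ a : AMZV.WordAlgebra F, Coalgebra.comul (R := F) (e a) =
        TensorProduct.map e.toLinearMap e.toLinearMap (AMZV.comul a)) ∧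
      (∀ a : AMZV.WordAlgebra F, Coalgebra.counit (R := F) (e a) = AMZV.counit a) ∧
      -- graded by the weight, connected, of finite type
      AMZV.IsGradedHopf (fun n => (AMZV.weightPart F n).map e.toLinearMap) ∧
      AMZV.IsConnected (fun n => (AMZV.weightPart F n).map e.toLinearMap) ∧
      AMZV.IsFiniteType (fun n => (AMZV.weightPart F n).map e.toLinearMap) ∧
      -- the antipode is the one determined by the connected graded bialgebra structure
      AMZV.AntipodeIsRecursive (fun n => (AMZV.weightPart F n).map e.toLinearMap) :=
  -- The identification is the identity map, so compatibility with product, unit and counit is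
  -- definitional.
  ⟨AMZV.ShuffleAlgebra F, inferInstance, inferInstance, AMZV.toShuffle F,
    fun _ _ => rfl, fun _ => rfl,
    fun a => (LinearMap.congr_fun (TensorProduct.map_id (R := F) (M := AMZV.WordAlgebra F)
      (N := AMZV.WordAlgebra F)) (AMZV.comul a)).symm,
    fun _ => rfl, AMZV.isGradedHopf_shufflePart F,
    (AMZV.isConnectedGrading_shufflePart F).zero_eq, AMZV.isFiniteType_shufflePart F,
    (AMZV.isConnectedGrading_shufflePart F).antipodeIsRecursive⟩
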